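/- Let $F$ be a field and let $A$ be a (finite-dimensional) central simple $F$-algebra of degree $n$, i.e. $\dim_F A=n^2$. For $0\le k\le n$ the generalized Severi--Brauer variety $V_k(A)$ is the closed subscheme of the Grassmannian $\mathrm{Gr}(kn,A)$ whose points over a commutative $F$-algebra $R$ are the right ideals $I$ of $A_R=A\otimes_F R$ such that $A_R/I$ is a finite projective $R$-module of constant rank $n^2-kn$. Let $L/F$ be a Galois extension splitting $A$, fix an isomorphism $A_L\cong \mathrm{End}_L(V)$ with $V$ a finite-dimensional $L$-vector space, and identify $V_k(A)_L\cong V_k(\mathrm{End}_L(V))\cong \mathrm{Gr}_L(k,V)$ via $I\mapsto \mathrm{im}\, I$ (the sum of the images of the elements of $I$). Let $P\subset V_k(A)$ be a closed subscheme such that $P_L=\mathrm{Gr}_L(k,W)\subset \mathrm{Gr}_L(k,V)$ for some $L$-subspace $W\subset V$ with $k\le\dim_L W$ (so that $P$ is non-empty, and hence a geometrically integral closed subvariety). Then there is a central simple $F$-algebra $B$, Brauer equivalent to $A$ and of degree at least $k$, such that $P\cong V_k(B)$ as $F$-schemes. -/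

import Mathlib

open CategoryTheory TensorProduct

universe u v w

/-- A closed subfunctor of a functor `X` on commutative `F`-algebras: for every point `x` of `X`
over `R` (that is, every morphism `Spec R ⟶ X`) the preimage of `G` in `Spec R` is the closed
subscheme cut out by an ideal `𝔞` of `R`.  When `X` is the functor of points of an `F`-scheme, the
closed subfunctors are exactly the functors of points of its closed subschemes. -/
def CategoryTheory.Subfunctor.IsClosedSubfunctor {F : Type u} [CommRing F]
    {X : CommAlgCat.{u} F ⥤ Type w} (G : Subfunctor X) : Prop :=
  ∀ (R : CommAlgCat.{u} F) (x : X.obj R), ∃ 𝔞 : Ideal R,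
    ∀ (S : CommAlgCat.{u} F) (f : R ⟶ S), X.map f x ∈ G.obj S ↔ ∀ r ∈ 𝔞, f.hom r = 0

section GeneralizedSeveriBrauer

variable (F : Type u) [Field F] (A : Type v) [Ring A] [Algebra F A]

/-- The degree `n` of a central simple algebra of dimension `n ^ 2`. -/
noncomputable def algDegree : ℕ := Nat.sqrt (Module.finrank F A)

/-- An `R`-submodule of `A_R = R ⊗ A` which is a right ideal. -/
def IsRightIdeal {R : Type*} [CommRing R] [Algebra F R] (I : Submodule R (R ⊗[F] A)) : Prop :=
  ∀ x ∈ I, ∀ a : R ⊗[F] A, x * a ∈ I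

/-- Right ideals are preserved by base change. -/
theorem isRightIdeal_map {q : ℕ} {R S : Type u} [CommRing R] [Algebra F R] [CommRing S]
    [Algebra F S] (f : R →ₐ[F] S) (I : Module.Grassmannian R (R ⊗[F] A) q)
    (hI : IsRightIdeal F A I.toSubmodule) :
    IsRightIdeal F A (Module.Grassmannian.map f I).toSubmodule := by
  let : Algebra R S := f.toAlgebra
  let : IsScalarTower F R S :=
    IsScalarTower.of_algebraMap_eq' <| IsScalarTower.algebraMap_eq F R S
  intro x hx a
  rw [Module.Grassmannian.map_toSubmodule] at hx ⊢
  rw [LinearMap.mem_ker] at hx ⊢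
  induction a using TensorProduct.induction_on with
  | zero => rw [mul_zero, map_zero]
  | add a b ha hb => rw [mul_add, map_add, ha, hb, add_zero]
  | tmul s a =>
    let r : (R ⊗[F] A) →ₗ[R] (R ⊗[F] A) := LinearMap.mulRight R (1 ⊗ₜ[F] a)
    let μ := I.toSubmodule.mapQ I.toSubmodule r (fun y hy => hI y hy _)
    have key : ∀ y : S ⊗[F] A,
        Module.Grassmannian.baseChangeMkQ S I.toSubmodule (y * (s ⊗ₜ a)) =
          s • μ.baseChange S (Module.Grassmannian.baseChangeMkQ S I.toSubmodule y) := by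
      intro y
      induction y using TensorProduct.induction_on with
      | zero => simp
      | add y z hy hz => rw [add_mul, map_add, hy, hz, map_add, map_add, smul_add]
      | tmul t b =>
        have h : μ (I.toSubmodule.mkQ (1 ⊗ₜ[F] b)) = I.toSubmodule.mkQ (1 ⊗ₜ[F] (b * a)) := by
          change I.toSubmodule.mkQ (r (1 ⊗ₜ[F] b)) = _
          simp [r]
        simp only [Module.Grassmannian.baseChangeMkQ, LinearMap.comp_apply,
          LinearEquiv.coe_coe, Algebra.TensorProduct.tmul_mul_tmul,
          TensorProduct.AlgebraTensorModule.cancelBaseChange_symm_tmul, LinearMap.baseChange_tmul,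
          h, TensorProduct.smul_tmul', smul_eq_mul, mul_comm s t]
    rw [key, hx, map_zero, smul_zero]

/-- The `k`-th generalized Severi-Brauer variety `V_k(A)` of a central simple `F`-algebra of
degree `n`, for `k ≤ n`, given by its functor of points
`R ↦ {I ∈ Gr(kn, A)(R) | I is a right ideal of A_R}`.  Here `I ∈ Gr(kn, A)(R)` means that `I` is
an `R`-submodule of `A_R` such that `A_R / I` is finite projective of constant rank `n² - kn`;
Mathlib's Grassmannian is indexed by this rank of the quotient. -/
noncomputable def generalizedSeveriBrauer (k : ℕ) :
    Subfunctor (Module.Grassmannian.functor.{u, v, u} (R := F) (M := A)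
      (Module.finrank F A - k * algDegree F A)) where
  obj _ := {I | IsRightIdeal F A I.toSubmodule}
  map f I hI := isRightIdeal_map F A f.hom I hI

end GeneralizedSeveriBrauer

section Splitting

variable {F : Type u} [Field F] {A : Type v} [Ring A] [Algebra F A]
  {L : Type u} [Field L] [Algebra F L] {V : Type w} [AddCommGroup V] [Module L V]

/-- The action of `A_R` on `V_R = R ⊗[L] V` obtained from a splitting
`φ : A_L ≅ End_L(V)` over `L`, for an `L`-algebra `R`:
`A_R ≅ R ⊗[L] A_L ≅ R ⊗[L] End_L(V) → End_R(V_R)`. -/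
noncomputable def splittingAction (φ : (L ⊗[F] A) ≃ₐ[L] Module.End L V)
    (R : Type u) [CommRing R] [Algebra F R] [Algebra L R] [IsScalarTower F L R] :
    (R ⊗[F] A) →ₗ[R] Module.End R (R ⊗[L] V) :=
  (Algebra.TensorProduct.lift (Algebra.ofId R _)
      ((Module.End.baseChangeHom L R V).comp φ.toAlgHom)
      (fun r _ => Algebra.commutes r _)).toLinearMap ∘ₗ
    (TensorProduct.AlgebraTensorModule.cancelBaseChange F L R R A).symm.toLinearMap

theorem splittingAction_tmul (φ : (L ⊗[F] A) ≃ₐ[L] Module.End L V)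
    (R : Type u) [CommRing R] [Algebra F R] [Algebra L R] [IsScalarTower F L R] (r : R) (a : A) :
    splittingAction φ R (r ⊗ₜ a) = r • (φ (1 ⊗ₜ a)).baseChange R := by
  simp [splittingAction, Algebra.ofId_apply, Algebra.smul_def, Module.End.baseChangeHom,
    LinearMap.baseChangeHom]

/-- The image `im I ⊆ V_R` of `I ⊆ A_R ≅ End_R(V_R)`: the sum of the images of all
elements of `I`. -/
noncomputable def idealImage (φ : (L ⊗[F] A) ≃ₐ[L] Module.End L V)
    {R : Type u} [CommRing R] [Algebra F R] [Algebra L R] [IsScalarTower F L R]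
    (I : Submodule R (R ⊗[F] A)) : Submodule R (R ⊗[L] V) :=
  ⨆ x ∈ I, LinearMap.range (splittingAction φ R x)

/-- `IsSubgrassmannian φ P W` says that `P_L = Gr_L(k, W)` inside
`V_k(A)_L ≅ V_k(End_L V) ≅ Gr_L(k, V)`, where the last isomorphism is `I ↦ im I`:
for each commutative `L`-algebra `R`, a point `I` of `V_k(A)` over `R` belongs to `P` iff `im I` is
(the image in `V_R` of) a point of `Gr_L(k, W)` over `R`. -/
def IsSubgrassmannian {k : ℕ} (φ : (L ⊗[F] A) ≃ₐ[L] Module.End L V)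
    (P : Subfunctor (generalizedSeveriBrauer F A k).toFunctor) (W : Submodule L V) : Prop :=
  ∀ (R : Type u) [CommRing R] [Algebra F R] [Algebra L R] [IsScalarTower F L R]
    (I : (generalizedSeveriBrauer F A k).toFunctor.obj (CommAlgCat.of F R)),
    I ∈ P.obj (CommAlgCat.of F R) ↔
      ∃ N : Module.Grassmannian R (R ⊗[L] W) (Module.finrank L W - k),
        N.toSubmodule.map (W.subtype.baseChange R) = idealImage φ I.1.toSubmodule

end Splitting

/-!
The closed subscheme `P` turns out to be cut out by an idempotent: there is `e ∈ A` such that,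
over every commutative `F`-algebra `R`, the points of `P` are exactly the points `I` of `V_k(A)`
with `I ⊆ e A_R`. Then `B = e A e` is the required algebra, and the isomorphism `P ≅ V_k(B)` is
the Morita correspondence `I ↦ I ∩ B_R`.

To find `e` when `k > 0`, consider the right ideal `D` of `A_L ≅ End_L(V)` of all endomorphisms
with image in `W`. It is a sum of right ideals `Hom(V, U)` with `U ⊆ W` of dimension `k`, and
these are the `L`-points of `P`. As `P` is defined over `F`, the Galois group permutes its
`L`-points, so `D` is Galois stable (`galAction_mem_of_isSubgrassmannian`). By Galois descent
`D` is the extension of a right ideal of `A`, and as `A` is semisimple this ideal is generated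
by an idempotent `e`, which acts on `V` as a projection onto `W`
(`exists_idempotent_of_isSubgrassmannian`). If `k = 0`, then `V_0(A)` is a point, `W` is not
determined by `P`, and `e = 1` is used instead.

Over an `L`-algebra `R`, the image of a point `I` of `V_k(A)` is a point of `Gr(k, W)` if and
only if it is contained in `W_R`, that is, if and only if `e x = x` for all `x ∈ I`; the rank
conditions match because `End(M) / Hom(M, N)` is a power of `M / N` (`exists_grassmannian_iff`).
Over a general `R` the same description of `P` follows because `R → L ⊗ R` is injective: both
the closed subscheme condition and the condition `e x = x` may be tested after this base change
(`mem_iff_idempotent_mul_eq_self`).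

The Morita theory of the corner is made explicit through two matrices `p`, `q` over `A` with
`q p = 1` and `p q = e` (`FullCorner`); they exist because all modules over a simple Artinian
ring are sums of one simple module. They give `M_s(A) ≅ M_r(B)`, hence Brauer equivalence and
the fact that `B` is central simple, and for every right ideal `I ⊆ e A_R` an isomorphism
`(A_R / I) ^ s ≅ (A_R / e A_R) ^ s × (B_R / I ∩ B_R) ^ r`, which matches the rank conditions of
`V_k(A)` and `V_k(B)` (`FullCorner.pointsIso`).
-/

/-! ### Modules of constant rank -/

/-- A finite projective module of constant rank `n`. -/
structure HasConstRank (R : Type*) [CommRing R] (M : Type*) [AddCommGroup M] [Module R M]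
    (n : ℕ) : Prop where
  finite : Module.Finite R M
  projective : Module.Projective R M
  rank_eq : ∀ p, Module.rankAtStalk (R := R) M p = n

namespace HasConstRank

variable {R : Type*} [CommRing R] {M N : Type*} [AddCommGroup M] [Module R M]
  [AddCommGroup N] [Module R N] {m n : ℕ}

theorem congr (h : HasConstRank R M n) (f : M ≃ₗ[R] N) : HasConstRank R N n := by
  have := h.finite
  have := h.projective
  exact ⟨Module.Finite.equiv f, Module.Projective.of_equiv f,
    fun p => by rw [← Module.rankAtStalk_eq_of_equiv f, h.rank_eq]⟩

theorem of_free [Module.Finite R M] [Module.Free R M] (h : Module.finrank R M = n) :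
    HasConstRank R M n :=
  ⟨inferInstance, inferInstance, fun p => by simp [h]⟩

theorem finrank_eq {K : Type*} [Field K] {M : Type*} [AddCommGroup M] [Module K M]
    (h : HasConstRank K M n) : Module.finrank K M = n := by
  simpa using h.rank_eq ⊥

theorem prod (h : HasConstRank R M m) (h' : HasConstRank R N n) :
    HasConstRank R (M × N) (m + n) := by
  have := h.finite
  have := h.projective
  have := h'.finite
  have := h'.projective
  exact ⟨inferInstance, inferInstance,
    fun p => by rw [Module.rankAtStalk_prod, Pi.add_apply, h.rank_eq, h'.rank_eq]⟩

theorem of_prod (h : HasConstRank R (M × N) (m + n)) (h' : HasConstRank R M m) :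
    HasConstRank R N n := by
  have := h.finite
  have := h.projective
  have := h'.finite
  have := h'.projective
  have : Module.Finite R N := .of_surjective (LinearMap.snd R M N) LinearMap.snd_surjective
  have : Module.Projective R N :=
    .of_split (LinearMap.inr R M N) (LinearMap.snd R M N) (LinearMap.snd_comp_inr ..)
  refine ⟨inferInstance, inferInstance, fun p => ?_⟩
  have := h.rank_eq p
  rw [Module.rankAtStalk_prod, Pi.add_apply, h'.rank_eq] at this
  lia

theorem pi (h : HasConstRank R M n) (s : ℕ) : HasConstRank R (Fin s → M) (s * n) := by
  have := h.finite
  have := h.projective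
  have : Module.Projective R (Fin s → M) :=
    .of_equiv (DFinsupp.linearEquivFunOnFintype (R := R) (M := fun _ : Fin s => M))
  refine ⟨inferInstance, inferInstance, fun p => ?_⟩
  rw [Module.rankAtStalk_pi, finsum_eq_sum_of_fintype]
  simp [h.rank_eq]

theorem of_pi {s : ℕ} (hs : 0 < s) (h : HasConstRank R (Fin s → M) (s * n)) :
    HasConstRank R M n := by
  have := h.finite
  have := h.projective
  let i : Fin s := ⟨0, hs⟩
  have : Module.Finite R M :=
    .of_surjective (LinearMap.proj (R := R) (φ := fun _ : Fin s => M) i)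
      (Function.surjective_eval i)
  have : Module.Projective R M :=
    .of_split (LinearMap.single R (fun _ : Fin s => M) i) (LinearMap.proj i)
      (LinearMap.proj_comp_single_same ..)
  refine ⟨inferInstance, inferInstance, fun p => ?_⟩
  have := h.rank_eq p
  rw [Module.rankAtStalk_pi, finsum_eq_sum_of_fintype] at this
  simpa [hs.ne'] using this

theorem baseChange {K : Type*} [Field K] [Algebra K R] {U : Type*} [AddCommGroup U] [Module K U]
    [Module.Finite K U] (h : Module.finrank K U = n) : HasConstRank R (R ⊗[K] U) n :=
  ⟨inferInstance, inferInstance, fun p => by rw [Module.rankAtStalk_baseChange]; simp [h]⟩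

/-- The point of the Grassmannian given by a submodule whose quotient has constant rank. -/
def grassmannian {S : Submodule R M} (h : HasConstRank R (M ⧸ S) n) :
    Module.Grassmannian R M n :=
  ⟨S, h.finite, h.projective, h.rank_eq⟩

theorem of_grassmannian (S : Module.Grassmannian R M n) :
    HasConstRank R (M ⧸ S.toSubmodule) n :=
  ⟨S.finite_quotient, S.projective_quotient, S.rankAtStalk_eq⟩

end HasConstRank

/-! ### Quotients and complements -/

section Quotients

variable {R : Type*} [CommRing R] {M X C : Type*} [AddCommGroup M] [Module R M]
  [AddCommGroup X] [Module R X] [AddCommGroup C] [Module R C]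

/-- If `i : X → M` is split by `π` with cokernel `g : M → C`, then `M ⧸ i N ≃ C × X ⧸ N`. -/
noncomputable def quotientMapEquivProd (i : X →ₗ[R] M) (π : M →ₗ[R] X) (g : M →ₗ[R] C)
    (hπ : ∀ x, π (i x) = x) (hg : Function.Surjective g) (hgi : ∀ m, g m = 0 ↔ i (π m) = m)
    (N : Submodule R X) : (M ⧸ N.map i) ≃ₗ[R] C × (X ⧸ N) :=
  let f : M →ₗ[R] C × (X ⧸ N) := g.prod (N.mkQ ∘ₗ π)
  have hgi0 : ∀ x, g (i x) = 0 := fun x => (hgi _).2 (by rw [hπ])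
  have hker : N.map i = LinearMap.ker f := by
    ext m
    change _ ↔ (g m, N.mkQ (π m)) = 0
    rw [Prod.mk_eq_zero, Submodule.mkQ_apply, Submodule.Quotient.mk_eq_zero, Submodule.mem_map]
    constructor
    · rintro ⟨x, hx, rfl⟩
      exact ⟨hgi0 x, by rwa [hπ]⟩
    · rintro ⟨h1, h2⟩
      exact ⟨π m, h2, (hgi m).1 h1⟩
  have hf : Function.Surjective f := by
    rintro ⟨c, y⟩
    obtain ⟨t, rfl⟩ := hg c
    obtain ⟨x, rfl⟩ := N.mkQ_surjective y
    refine ⟨i x + (t - i (π t)), ?_⟩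
    simp [f, hπ, hgi0]
  (Submodule.quotEquivOfEq _ _ hker).trans (f.quotKerEquivOfSurjective hf)

end Quotients

/-! ### Right ideals of endomorphism algebras -/

section EndIdeals

variable {R T M : Type*} [CommRing R] [Ring T] [Algebra R T] [AddCommGroup M] [Module R M]

/-- The submodule of all elements acting on `M` with image in `N`. -/
def idealOfImage (Ψ : T →ₗ[R] Module.End R M) (N : Submodule R M) : Submodule R T where
  carrier := {x | ∀ m, Ψ x m ∈ N}
  zero_mem' := by simp
  add_mem' ha hb m := by simpa using N.add_mem (ha m) (hb m)
  smul_mem' r x hx m := by simpa using N.smul_mem r (hx m)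

theorem mem_idealOfImage {Ψ : T →ₗ[R] Module.End R M} {N : Submodule R M} {x : T} :
    x ∈ idealOfImage Ψ N ↔ ∀ m, Ψ x m ∈ N := Iff.rfl

variable {Ψ : T →ₗ[R] Module.End R M} (hmul : ∀ x y, Ψ (x * y) = Ψ x * Ψ y)
  (hbij : Function.Bijective Ψ) {n : ℕ} (b : Module.Basis (Fin n) R M)

include hmul in
theorem mul_mem_idealOfImage {N : Submodule R M} {x : T} (hx : x ∈ idealOfImage Ψ N) (y : T) :
    x * y ∈ idealOfImage Ψ N := fun m => by
  rw [hmul]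
  exact hx _

include hbij b in
/-- Every element of `N` is a value of an element of the ideal attached to `N`. -/
theorem iSup_range_idealOfImage (N : Submodule R M) (hn : 0 < n) :
    ⨆ x ∈ idealOfImage Ψ N, LinearMap.range (Ψ x) = N := by
  apply le_antisymm
  · refine iSup₂_le fun x hx => ?_
    rintro _ ⟨m, rfl⟩
    exact hx m
  · intro y hy
    obtain ⟨x, hx⟩ := hbij.2 ((b.coord ⟨0, hn⟩).smulRight y)
    have hxN : x ∈ idealOfImage Ψ N := fun m => by
      rw [hx]
      exact N.smul_mem _ hy
    refine Submodule.mem_iSup_of_mem x (Submodule.mem_iSup_of_mem hxN ⟨b ⟨0, hn⟩, ?_⟩)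
    simp [hx]

include hmul hbij b in
/-- A right ideal of an endomorphism algebra consists of all endomorphisms with image in the sum
of the images of its elements. -/
theorem idealOfImage_iSup_range (I : Submodule R T) (hI : ∀ x ∈ I, ∀ a, x * a ∈ I) :
    idealOfImage Ψ (⨆ x ∈ I, LinearMap.range (Ψ x)) = I := by
  apply le_antisymm
  · intro x hx
    -- rank one endomorphisms with value in the image of `I` belong to `I`
    have key : ∀ y ∈ ⨆ x ∈ I, LinearMap.range (Ψ x), ∀ (f : M →ₗ[R] R) (z : T),
        Ψ z = f.smulRight y → z ∈ I := by
      intro y hy f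
      induction hy using Submodule.iSup_induction' with
      | mem x y hy =>
        induction hy using Submodule.iSup_induction' with
        | mem hx y hy =>
          obtain ⟨m, rfl⟩ := hy
          intro z hz
          obtain ⟨a, ha⟩ := hbij.2 (f.smulRight m)
          have : z = x * a := hbij.1 <| by
            rw [hmul, hz, ha]
            ext
            simp
          exact this ▸ hI x hx a
        | zero =>
          intro z hz
          have : z = 0 := hbij.1 <| by rw [hz, map_zero, LinearMap.smulRight_zero]
          exact this ▸ I.zero_mem
        | add y y' _ _ h h' =>
          intro z hz
          obtain ⟨a, ha⟩ := hbij.2 (f.smulRight y)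
          obtain ⟨a', ha'⟩ := hbij.2 (f.smulRight y')
          have : z = a + a' := hbij.1 <| by
            rw [map_add, hz, ha, ha']
            ext
            simp
          exact this ▸ I.add_mem (h a ha) (h' a' ha')
      | zero =>
        intro z hz
        have : z = 0 := hbij.1 <| by rw [hz, map_zero, LinearMap.smulRight_zero]
        exact this ▸ I.zero_mem
      | add y y' _ _ h h' =>
        intro z hz
        obtain ⟨a, ha⟩ := hbij.2 (f.smulRight y)
        obtain ⟨a', ha'⟩ := hbij.2 (f.smulRight y')
        have : z = a + a' := hbij.1 <| by
          rw [map_add, hz, ha, ha']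
          ext
          simp
        exact this ▸ I.add_mem (h a ha) (h' a' ha')
    choose z hz using fun i => hbij.2 ((b.coord i).smulRight (Ψ x (b i)))
    have : x = ∑ i, z i := hbij.1 <| b.ext fun j => by
      rw [map_sum, LinearMap.sum_apply]
      simp [hz, Finsupp.single_apply]
    rw [this]
    exact I.sum_mem fun i _ => key _ (hx (b i)) _ _ (hz i)
  · intro x hx m
    exact Submodule.mem_iSup_of_mem x (Submodule.mem_iSup_of_mem hx ⟨m, rfl⟩)

/-- The quotient of an endomorphism algebra by the right ideal attached to `N` is a power of the
quotient by `N`: send an endomorphism to the classes of its values on a basis. -/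
noncomputable def quotientIdealOfImageEquiv (hsurj : Function.Surjective Ψ) (N : Submodule R M) :
    (T ⧸ idealOfImage Ψ N) ≃ₗ[R] (Fin n → M ⧸ N) :=
  let f : T →ₗ[R] (Fin n → M ⧸ N) :=
    LinearMap.pi fun i => N.mkQ ∘ₗ LinearMap.applyₗ (b i) ∘ₗ Ψ
  have hker : idealOfImage Ψ N = LinearMap.ker f := by
    ext x
    rw [LinearMap.mem_ker, funext_iff, mem_idealOfImage]
    simp only [f, LinearMap.pi_apply, LinearMap.comp_apply, Submodule.mkQ_apply, Pi.zero_apply,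
      Submodule.Quotient.mk_eq_zero, LinearMap.applyₗ_apply_apply]
    refine ⟨fun h i => h _, fun h m => ?_⟩
    rw [← b.sum_repr m, map_sum]
    exact N.sum_mem fun i _ => by
      rw [map_smul]
      exact N.smul_mem _ (h i)
  have hf : Function.Surjective f := fun y => by
    choose m hm using fun i => N.mkQ_surjective (y i)
    obtain ⟨x, hx⟩ := hsurj (b.constr R m)
    refine ⟨x, funext fun i => ?_⟩
    simp [f, hx, ← hm]
  (Submodule.quotEquivOfEq _ _ hker).trans (f.quotKerEquivOfSurjective hf)

end EndIdeals

/-! ### Full corners -/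

/-- The algebra `B` presented as a full corner `e T e` of `T`: `ι` is the inclusion of the corner
and `ρ x = e x e` the projection onto it.  Fullness is recorded by matrices `p` and `q` with
`q p = 1` and `p q = e`, that is, by an isomorphism `T ^ s ≃ (e T) ^ r` of right modules. -/
structure FullCorner (R T B : Type*) [CommRing R] [Ring T] [Algebra R T] [Ring B] [Algebra R B]
    (r s : ℕ) where
  e : T
  ι : B →ₗ[R] T
  ρ : T →ₗ[R] B
  ρ_ι : ∀ b, ρ (ι b) = b
  ι_ρ : ∀ x, ι (ρ x) = e * x * e
  ι_mul : ∀ a b, ι (a * b) = ι a * ι b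
  ι_one : ι 1 = e
  p : Matrix (Fin r) (Fin s) T
  q : Matrix (Fin s) (Fin r) T
  q_mul_p : q * p = 1
  p_mul_q : p * q = Matrix.diagonal fun _ => e

namespace FullCorner

variable {R T B : Type*} [CommRing R] [Ring T] [Algebra R T] [Ring B] [Algebra R B] {r s : ℕ}
  (D : FullCorner R T B r s)

theorem ι_injective : Function.Injective D.ι := Function.LeftInverse.injective D.ρ_ι

theorem e_mul_e : D.e * D.e = D.e := by
  rw [← D.ι_one, ← D.ι_mul, one_mul]

theorem e_mul_ι (b : B) : D.e * D.ι b = D.ι b := by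
  rw [← D.ι_one, ← D.ι_mul, one_mul]

theorem ι_mul_e (b : B) : D.ι b * D.e = D.ι b := by
  rw [← D.ι_one, ← D.ι_mul, mul_one]

theorem ρ_e : D.ρ D.e = 1 := by rw [← D.ι_one, D.ρ_ι]

theorem q_mul_e (i : Fin r) (j : Fin s) : D.q j i * D.e = D.q j i := by
  have : D.q * (Matrix.diagonal (fun _ => D.e) : Matrix (Fin r) (Fin r) T) = D.q := by
    rw [← D.p_mul_q, ← Matrix.mul_assoc, D.q_mul_p, Matrix.one_mul]
  simpa using congrFun (congrFun this j) i

theorem sum_q_mul_p (j j' : Fin s) :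
    ∑ i, D.q j i * D.p i j' = if j = j' then 1 else 0 := by
  rw [← Matrix.mul_apply, D.q_mul_p, Matrix.one_apply]

theorem sum_p_mul_q (i i' : Fin r) :
    ∑ j, D.p i j * D.q j i' = if i = i' then D.e else 0 := by
  rw [← Matrix.mul_apply, D.p_mul_q, Matrix.diagonal_apply]

theorem map_ι_map_ρ (X : Matrix (Fin s) (Fin s) T) :
    ((D.p * X * D.q).map D.ρ).map D.ι = D.p * X * D.q := by
  have h : ∀ Y : Matrix (Fin r) (Fin r) T, (Y.map D.ρ).map D.ι =
      Matrix.diagonal (fun _ => D.e) * Y * Matrix.diagonal (fun _ => D.e) := fun Y => by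
    ext i j
    simp [D.ι_ρ]
  rw [h, ← D.p_mul_q]
  calc D.p * D.q * (D.p * X * D.q) * (D.p * D.q)
      = D.p * (D.q * D.p) * X * (D.q * D.p) * D.q := by simp only [Matrix.mul_assoc]
    _ = _ := by rw [D.q_mul_p, Matrix.mul_one, Matrix.mul_one]

theorem map_ι_mul (X Y : Matrix (Fin r) (Fin r) B) :
    (X * Y).map D.ι = X.map D.ι * Y.map D.ι := by
  ext i j
  simp [Matrix.mul_apply, D.ι_mul]

/-- A full corner is Morita equivalent, in the sense of isomorphic matrix algebras, to the whole
algebra. -/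
def matrixEquiv : Matrix (Fin s) (Fin s) T ≃ₐ[R] Matrix (Fin r) (Fin r) B where
  toFun X := (D.p * X * D.q).map D.ρ
  invFun Y := D.q * Y.map D.ι * D.p
  left_inv X := by
    change D.q * ((D.p * X * D.q).map D.ρ).map D.ι * D.p = X
    rw [map_ι_map_ρ]
    calc D.q * (D.p * X * D.q) * D.p = (D.q * D.p) * X * (D.q * D.p) := by
          simp only [Matrix.mul_assoc]
      _ = X := by rw [D.q_mul_p, Matrix.one_mul, Matrix.mul_one]
  right_inv Y := by
    have : D.p * (D.q * Y.map D.ι * D.p) * D.q = Y.map D.ι :=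
      calc D.p * (D.q * Y.map D.ι * D.p) * D.q
          = (D.p * D.q) * Y.map D.ι * (D.p * D.q) := by simp only [Matrix.mul_assoc]
        _ = _ := by
          rw [D.p_mul_q]
          ext i j
          simp [D.e_mul_ι, D.ι_mul_e]
    change (D.p * (D.q * Y.map D.ι * D.p) * D.q).map D.ρ = Y
    rw [this]
    ext i j
    simp [D.ρ_ι]
  map_mul' X Y := by
    apply Matrix.map_injective D.ι_injective
    change ((D.p * (X * Y) * D.q).map D.ρ).map D.ι =
      ((D.p * X * D.q).map D.ρ * (D.p * Y * D.q).map D.ρ).map D.ι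
    rw [map_ι_mul, map_ι_map_ρ, map_ι_map_ρ, map_ι_map_ρ]
    calc D.p * (X * Y) * D.q = D.p * X * (1 : Matrix (Fin s) (Fin s) T) * Y * D.q := by
          simp only [Matrix.mul_assoc, Matrix.one_mul]
      _ = _ := by
        rw [← D.q_mul_p]
        simp only [Matrix.mul_assoc]
  map_add' X Y := by
    rw [Matrix.mul_add, Matrix.add_mul]
    ext i j
    simp
  commutes' c := by
    rw [Algebra.algebraMap_eq_smul_one, Matrix.mul_smul, Matrix.mul_one, Matrix.smul_mul,
      D.p_mul_q, Algebra.algebraMap_eq_smul_one]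
    ext i j
    by_cases h : i = j
    · subst h
      simp [D.ρ_e]
    · simp [h]

/-- Full corners are preserved by extension of scalars. -/
noncomputable def baseChange (S : Type*) [CommRing S] [Algebra R S] :
    FullCorner S (S ⊗[R] T) (S ⊗[R] B) r s where
  e := 1 ⊗ₜ D.e
  ι := D.ι.baseChange S
  ρ := D.ρ.baseChange S
  ρ_ι b := by
    rw [← LinearMap.comp_apply, ← LinearMap.baseChange_comp,
      show D.ρ ∘ₗ D.ι = LinearMap.id from LinearMap.ext D.ρ_ι, LinearMap.baseChange_id]
    rfl
  ι_ρ x := by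
    induction x using TensorProduct.induction_on with
    | zero => simp
    | add x y hx hy => rw [map_add, map_add, hx, hy, mul_add, add_mul]
    | tmul c x => simp [D.ι_ρ]
  ι_mul x y := by
    induction x using TensorProduct.induction_on with
    | zero => simp
    | add x x' hx hx' => rw [add_mul, map_add, hx, hx', map_add, add_mul]
    | tmul c x =>
      induction y using TensorProduct.induction_on with
      | zero => simp
      | add y y' hy hy' => rw [mul_add, map_add, hy, hy', map_add, mul_add]
      | tmul c' y => simp [D.ι_mul]
  ι_one := by rw [Algebra.TensorProduct.one_def, LinearMap.baseChange_tmul, D.ι_one]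
  p := D.p.map (Algebra.TensorProduct.includeRight : T →ₐ[R] S ⊗[R] T)
  q := D.q.map (Algebra.TensorProduct.includeRight : T →ₐ[R] S ⊗[R] T)
  q_mul_p := by
    rw [← Matrix.map_mul, D.q_mul_p, Matrix.map_one _ (map_zero _) (map_one _)]
  p_mul_q := by
    rw [← Matrix.map_mul, D.p_mul_q, Matrix.diagonal_map (map_zero _)]
    rfl

/-- The right ideal of `T` attached to a right ideal `K` of the corner: all `x ∈ e T` such that
`e (x a) e ∈ K` for all `a`. If `e` is full, this is the right ideal generated by `K`. -/
def extend (K : Submodule R B) : Submodule R T where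
  carrier := {x | D.e * x = x ∧ ∀ a, D.ρ (x * a) ∈ K}
  zero_mem' := by simp
  add_mem' := by
    rintro x y ⟨h1, h2⟩ ⟨h3, h4⟩
    refine ⟨by rw [mul_add, h1, h3], fun a => ?_⟩
    rw [add_mul, map_add]
    exact K.add_mem (h2 a) (h4 a)
  smul_mem' := by
    rintro c x ⟨h1, h2⟩
    refine ⟨by rw [mul_smul_comm, h1], fun a => ?_⟩
    rw [smul_mul_assoc, map_smul]
    exact K.smul_mem c (h2 a)

theorem mul_mem_extend {K : Submodule R B} {x : T} (hx : x ∈ D.extend K) (a : T) :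
    x * a ∈ D.extend K := by
  refine ⟨by rw [← mul_assoc, hx.1], fun a' => ?_⟩
  rw [mul_assoc]
  exact hx.2 _

theorem comap_extend (K : Submodule R B) (hK : ∀ y ∈ K, ∀ b, y * b ∈ K) :
    (D.extend K).comap D.ι = K := by
  ext y
  constructor
  · intro h
    have := h.2 1
    rwa [mul_one, D.ρ_ι] at this
  · refine fun hy => ⟨D.e_mul_ι y, fun a => ?_⟩
    have : D.ρ (D.ι y * a) = y * D.ρ a := D.ι_injective <| by
      rw [D.ι_mul, D.ι_ρ, D.ι_ρ, ← mul_assoc, ← mul_assoc, D.e_mul_ι, ← mul_assoc, D.ι_mul_e]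
    rw [this]
    exact hK y hy _

theorem mul_mem_comap {I : Submodule R T} (hI : ∀ x ∈ I, ∀ a, x * a ∈ I) {y : B}
    (hy : y ∈ I.comap D.ι) (b : B) : y * b ∈ I.comap D.ι := by
  rw [Submodule.mem_comap, D.ι_mul]
  exact hI _ hy _

theorem ι_ρ_mul {x : T} (hx : D.e * x = x) (a : T) : D.ι (D.ρ (x * a)) = x * (a * D.e) := by
  rw [D.ι_ρ, ← mul_assoc, hx, mul_assoc]

/-- A right ideal contained in `e T` is recovered from its intersection with the corner. -/
theorem extend_comap (hs : 0 < s) {I : Submodule R T} (hI : ∀ x ∈ I, ∀ a, x * a ∈ I)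
    (he : ∀ x ∈ I, D.e * x = x) :
    D.extend (I.comap D.ι) = I := by
  ext x
  constructor
  · rintro ⟨hx, h⟩
    have hxq : x = ∑ i, x * D.q ⟨0, hs⟩ i * D.p i ⟨0, hs⟩ := by
      simp_rw [mul_assoc]
      rw [← Finset.mul_sum, D.sum_q_mul_p, if_pos rfl, mul_one]
    rw [hxq]
    refine I.sum_mem fun i _ => hI _ ?_ _
    have := h (D.q ⟨0, hs⟩ i)
    rwa [Submodule.mem_comap, D.ι_ρ_mul hx, D.q_mul_e] at this
  · refine fun hx => ⟨he x hx, fun a => ?_⟩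
    rw [Submodule.mem_comap, D.ι_ρ_mul (he x hx)]
    exact hI _ hx _

variable {C : Type*} [AddCommGroup C] [Module R C]

/-- For a right ideal `I ⊆ e T`, the quotients `T ⧸ I` and `B ⧸ I ∩ B` are related by
`(T ⧸ I) ^ s ≃ C ^ s × (B ⧸ I ∩ B) ^ r`, where `C ≃ T ⧸ e T`. -/
noncomputable def quotientEquiv (g : T →ₗ[R] C) (hg : Function.Surjective g)
    (hge : ∀ x, g x = 0 ↔ D.e * x = x) (I : Submodule R T) (hI : ∀ x ∈ I, ∀ a, x * a ∈ I)
    (he : ∀ x ∈ I, D.e * x = x) :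
    (Fin s → T ⧸ I) ≃ₗ[R] (Fin s → C) × (Fin r → B ⧸ I.comap D.ι) :=
  let f : (Fin s → T) →ₗ[R] (Fin s → C) × (Fin r → B ⧸ I.comap D.ι) :=
    (g.compLeft (Fin s)).prod <| LinearMap.pi fun i => (I.comap D.ι).mkQ ∘ₗ D.ρ ∘ₗ
      ∑ j, LinearMap.mulRight R (D.q j i) ∘ₗ LinearMap.proj j
  have hf2 : ∀ x i, (f x).2 i = (I.comap D.ι).mkQ (D.ρ (∑ j, x j * D.q j i)) := fun x i => by
    simp [f]
  have hf1 : ∀ x j, (f x).1 j = g (x j) := fun x j => rfl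
  have hker : Submodule.pi Set.univ (fun _ => I) = LinearMap.ker f := by
    ext x
    rw [LinearMap.mem_ker, Prod.ext_iff, funext_iff, funext_iff, Submodule.mem_pi]
    simp only [hf1, hf2, Prod.fst_zero, Prod.snd_zero, Pi.zero_apply, hge, Submodule.mkQ_apply,
      Submodule.Quotient.mk_eq_zero, Submodule.mem_comap, D.ι_ρ, Set.mem_univ, true_imp_iff]
    have hsum : (∀ j, D.e * x j = x j) → ∀ i,
        D.e * (∑ j, x j * D.q j i) * D.e = ∑ j, x j * D.q j i := fun hx i => by
      rw [Finset.mul_sum, Finset.sum_mul]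
      exact Finset.sum_congr rfl fun j _ => by rw [← mul_assoc, hx, mul_assoc, D.q_mul_e]
    constructor
    · intro hx
      refine ⟨fun j => he _ (hx j), fun i => ?_⟩
      rw [hsum fun j => he _ (hx j)]
      exact I.sum_mem fun j _ => hI _ (hx j) _
    · rintro ⟨hx, h⟩ j
      -- `x = x q p`, and the entries of `x q` belong to `I`
      have hxj : x j = ∑ i, (∑ j', x j' * D.q j' i) * D.p i j := by
        simp_rw [Finset.sum_mul, mul_assoc]
        rw [Finset.sum_comm]
        simp_rw [← Finset.mul_sum, D.sum_q_mul_p]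
        simp
      rw [hxj]
      exact I.sum_mem fun i _ => hI _ (by rw [← hsum hx]; exact h i) _
  have hf : Function.Surjective f := by
    rintro ⟨c, y⟩
    choose t ht using fun j => hg (c j)
    choose b hb using fun i => (I.comap D.ι).mkQ_surjective (y i)
    have hge0 : ∀ x, g (D.e * x) = 0 := fun x => (hge _).2 (by rw [← mul_assoc, D.e_mul_e])
    refine ⟨fun j => (t j - D.e * t j) + ∑ i, D.ι (b i) * D.p i j, ?_⟩
    refine Prod.ext (funext fun j => ?_) (funext fun i => ?_)
    · have : ∑ i, D.ι (b i) * D.p i j = D.e * ∑ i, D.ι (b i) * D.p i j := by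
        rw [Finset.mul_sum]
        exact Finset.sum_congr rfl fun i _ => by rw [← mul_assoc, D.e_mul_ι]
      rw [hf1, this, map_add, map_sub, hge0, hge0, sub_zero, add_zero, ht]
    · rw [hf2]
      have h1 : ∑ j, ((t j - D.e * t j) + ∑ i, D.ι (b i) * D.p i j) * D.q j i =
          (∑ j, (t j - D.e * t j) * D.q j i) + D.ι (b i) := by
        simp_rw [add_mul]
        rw [Finset.sum_add_distrib]
        congr 1
        simp_rw [Finset.sum_mul, mul_assoc]
        rw [Finset.sum_comm]
        simp_rw [← Finset.mul_sum, D.sum_p_mul_q]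
        simp [D.ι_mul_e]
      have h2 : D.ρ (∑ j, (t j - D.e * t j) * D.q j i) = 0 := D.ι_injective <| by
        rw [D.ι_ρ, map_zero, Finset.mul_sum, Finset.sum_mul]
        refine Finset.sum_eq_zero fun j _ => ?_
        rw [← mul_assoc, mul_sub, ← mul_assoc, D.e_mul_e, sub_self, zero_mul, zero_mul]
      rw [h1, map_add, h2, zero_add, D.ρ_ι, hb]
  (Submodule.quotientPi fun _ => I).symm.trans <|
    (Submodule.quotEquivOfEq _ _ hker).trans (f.quotKerEquivOfSurjective hf)

theorem hasConstRank_iff (hr : 0 < r) (hs : 0 < s) (g : T →ₗ[R] C) (hg : Function.Surjective g)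
    (hge : ∀ x, g x = 0 ↔ D.e * x = x) {a b c : ℕ} (hC : HasConstRank R C c)
    (habc : s * a = s * c + r * b) (I : Submodule R T) (hI : ∀ x ∈ I, ∀ a, x * a ∈ I)
    (he : ∀ x ∈ I, D.e * x = x) :
    HasConstRank R (T ⧸ I) a ↔ HasConstRank R (B ⧸ I.comap D.ι) b := by
  constructor
  · intro h
    have := (h.pi s).congr (D.quotientEquiv g hg hge I hI he)
    rw [habc] at this
    exact (this.of_prod (hC.pi s)).of_pi hr
  · intro h
    have := ((hC.pi s).prod (h.pi r)).congr (D.quotientEquiv g hg hge I hI he).symm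
    rw [← habc] at this
    exact this.of_pi hs

end FullCorner

/-! ### Corners of simple Artinian algebras -/

section Corner

variable {F : Type*} {A : Type*} [Field F] [Ring A] [Algebra F A] {e : A}

theorem mul_mul_mem_corner (he : IsIdempotentElem e) (x : A) :
    e * x * e ∈ Subsemigroup.corner e :=
  (Subsemigroup.mem_corner_iff he).2
    ⟨by rw [← mul_assoc, ← mul_assoc, he.eq], by rw [mul_assoc, he.eq]⟩

instance cornerModule (he : IsIdempotentElem e) : Module F he.Corner :=
  letI : SMul F he.Corner := ⟨fun c x => ⟨c • x.1, (Subsemigroup.mem_corner_iff he).2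
    ⟨by rw [mul_smul_comm, ((Subsemigroup.mem_corner_iff he).1 x.2).1],
      by rw [smul_mul_assoc, ((Subsemigroup.mem_corner_iff he).1 x.2).2]⟩⟩⟩
  Function.Injective.module F
    (⟨⟨Subtype.val, rfl⟩, fun _ _ => rfl⟩ : he.Corner →+ A) Subtype.val_injective fun _ _ => rfl

/-- The corner `e A e` as an algebra with unit `e`. -/
instance cornerAlgebra (he : IsIdempotentElem e) : Algebra F he.Corner :=
  Algebra.ofModule (fun _ _ _ => Subtype.ext (smul_mul_assoc ..))
    fun _ _ _ => Subtype.ext (mul_smul_comm ..)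

/-- Over a simple Artinian ring, finite free modules and nonzero ideals are powers of one simple
module, so some power of a nonzero ideal is free. -/
theorem exists_linearEquiv_pi_ideal {R : Type*} [Ring R] [IsSimpleRing R] [IsArtinianRing R]
    (J : Ideal R) (hJ : J ≠ ⊥) :
    ∃ r s : ℕ, 0 < r ∧ 0 < s ∧ Nonempty ((Fin s → R) ≃ₗ[R] (Fin r → J)) := by
  have := IsSimpleRing.isSemisimpleRing_iff_isArtinianRing.2 ‹IsArtinianRing R›
  have hiso := IsSimpleRing.isIsotypic R R
  obtain ⟨r, hr, S, hS, ⟨f⟩⟩ := hiso.linearEquiv_fun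
  obtain ⟨s, ⟨g⟩⟩ :=
    ((hiso S).of_injective J.subtype J.subtype_injective).linearEquiv_fun
  have hs : s ≠ 0 := by
    rintro rfl
    have := g.subsingleton
    exact hJ ((Submodule.subsingleton_iff_eq_bot).1 this)
  let swap : (Fin s → Fin r → S) ≃ₗ[R] (Fin r → Fin s → S) :=
    { toFun x i j := x j i
      invFun x j i := x i j
      map_add' _ _ := rfl
      map_smul' _ _ := rfl }
  exact ⟨r, s, Nat.pos_of_ne_zero hr.out, Nat.pos_of_ne_zero hs,
    ⟨(LinearEquiv.piCongrRight fun _ => f).trans <| swap.trans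
      (LinearEquiv.piCongrRight fun _ => g.symm)⟩⟩

open MulOpposite in
/-- A nonzero corner of a simple Artinian algebra is full. -/
theorem exists_fullCorner [IsSimpleRing A] [IsArtinianRing Aᵐᵒᵖ] (he : IsIdempotentElem e)
    (he0 : e ≠ 0) :
    ∃ r s : ℕ, 0 < r ∧ 0 < s ∧ ∃ D : FullCorner F A he.Corner r s, D.e = e := by
  obtain ⟨r, s, hr, hs, ⟨Φ⟩⟩ := exists_linearEquiv_pi_ideal (Ideal.span {op e}) <| by
    simpa using he0
  refine ⟨r, s, hr, hs, ?_⟩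
  let ê : Ideal.span {op e} := ⟨op e, Ideal.mem_span_singleton_self _⟩
  have hê : ∀ y : Ideal.span {op e}, y = y.1 • ê := fun y => Subtype.ext <| by
    obtain ⟨a, ha⟩ := Ideal.mem_span_singleton'.1 y.2
    change y.1 = y.1 * op e
    rw [← ha, mul_assoc, ← op_mul, he.eq]
  let P : Matrix (Fin r) (Fin s) A := Matrix.of fun i j => unop (Φ (Pi.single j 1) i).1
  let Q : Matrix (Fin s) (Fin r) A := Matrix.of fun j i => unop (Φ.symm (Pi.single i ê) j)
  have hΦ : ∀ x i, unop (Φ x i).1 = ∑ j, P i j * unop (x j) := fun x i => by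
    have : x = ∑ j, x j • Pi.single j (1 : Aᵐᵒᵖ) := by
      simp [← Pi.single_smul', Finset.univ_sum_single]
    conv_lhs => rw [this]
    simp [P]
  have hΦ' : ∀ y j, unop (Φ.symm y j) = ∑ i, Q j i * unop (y i).1 := fun y j => by
    have : y = ∑ i, (y i).1 • Pi.single i ê := by
      simp_rw [← Pi.single_smul', ← hê, Finset.univ_sum_single]
    conv_lhs => rw [this]
    simp [Q]
  refine ⟨
    { e := e
      ι :=
        { toFun := Subtype.val
          map_add' := fun _ _ => rfl
          map_smul' := fun _ _ => rfl }
      ρ :=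
        { toFun := fun x => ⟨e * x * e, mul_mul_mem_corner he x⟩
          map_add' := fun x y => Subtype.ext <| by
            change e * (x + y) * e = e * x * e + e * y * e
            rw [mul_add, add_mul]
          map_smul' := fun c x => Subtype.ext <| by
            change e * (c • x) * e = c • (e * x * e)
            rw [mul_smul_comm, smul_mul_assoc] }
      ρ_ι := fun b => Subtype.ext (by
        obtain ⟨h1, h2⟩ := (Subsemigroup.mem_corner_iff he).1 b.2
        change e * b.1 * e = b.1
        rw [h1, h2])
      ι_ρ := fun x => rfl
      ι_mul := fun a b => rfl
      ι_one := rfl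
      p := P
      q := Q
      q_mul_p := ?_
      p_mul_q := ?_ }, rfl⟩
  · ext j j'
    rw [Matrix.mul_apply, Matrix.one_apply]
    have := hΦ' (Φ (Pi.single j' 1)) j
    rw [Φ.symm_apply_apply] at this
    refine Eq.trans this.symm ?_
    by_cases h : j = j'
    · subst h
      simp
    · simp [h]
  · ext i i'
    rw [Matrix.mul_apply, Matrix.diagonal_apply]
    have := hΦ (Φ.symm (Pi.single i' ê)) i
    rw [Φ.apply_symm_apply] at this
    refine Eq.trans this.symm ?_
    by_cases h : i = i'
    · subst h
      simp [ê]
    · simp [h]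

end Corner

section MatrixDescent

variable {F : Type*} {B : Type*} [Field F] [Ring B] [Algebra F B] {r : ℕ}

theorem isSimpleRing_of_matrix (hr : 0 < r) [IsSimpleRing (Matrix (Fin r) (Fin r) B)] :
    IsSimpleRing B := by
  have : Nonempty (Fin r) := ⟨⟨0, hr⟩⟩
  exact ⟨(TwoSidedIdeal.orderIsoMatrix (n := Fin r) (R := B)).isSimpleOrder⟩

theorem isCentral_of_matrix (hr : 0 < r) [Algebra.IsCentral F (Matrix (Fin r) (Fin r) B)] :
    Algebra.IsCentral F B := by
  refine ⟨fun x hx => ?_⟩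
  have hX : Matrix.scalar (Fin r) x ∈ Subalgebra.center F (Matrix (Fin r) (Fin r) B) := by
    rw [Matrix.subalgebraCenter_eq_scalarAlgHom_map]
    exact ⟨x, hx, rfl⟩
  obtain ⟨c, hc⟩ := Algebra.IsCentral.out hX
  refine ⟨c, ?_⟩
  have := congrFun (congrFun hc ⟨0, hr⟩) ⟨0, hr⟩
  simpa [Matrix.algebraMap_matrix_apply, Algebra.ofId_apply] using this

end MatrixDescent

/-! ### Galois descent -/

section Descent

variable {F L A : Type*} [Field F] [Field L] [Algebra F L]
  [Ring A] [Algebra F A]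

/-- The semilinear action of a field automorphism on an extension of scalars. -/
noncomputable def galAction (A : Type*) [Ring A] [Algebra F A] (σ : L ≃ₐ[F] L) :
    L ⊗[F] A →ₐ[F] L ⊗[F] A :=
  Algebra.TensorProduct.map σ.toAlgHom (AlgHom.id F A)

@[simp]
theorem galAction_tmul (σ : L ≃ₐ[F] L) (l : L) (a : A) :
    galAction A σ (l ⊗ₜ a) = σ l ⊗ₜ a := rfl

theorem repr_galAction {ι : Type*} (b : Module.Basis ι F A) (σ : L ≃ₐ[F] L) (x : L ⊗[F] A)
    (i : ι) : (b.baseChange L).repr (galAction A σ x) i = σ ((b.baseChange L).repr x i) := by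
  induction x using TensorProduct.induction_on with
  | zero => simp
  | add x y hx hy => simp [hx, hy]
  | tmul l a => simp [Module.Basis.baseChange_repr_tmul]

theorem exists_eq_one_tmul_of_galAction_eq [IsGalois F L] [FiniteDimensional F A] (x : L ⊗[F] A)
    (hx : ∀ σ : L ≃ₐ[F] L, galAction A σ x = x) : ∃ a : A, x = 1 ⊗ₜ a := by
  let b := Module.finBasis F A
  have h : ∀ i, ∃ c : F, algebraMap F L c = (b.baseChange L).repr x i := fun i =>
    (InfiniteGalois.mem_range_algebraMap_iff_fixed _).2 fun σ => by
      rw [← repr_galAction, hx]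
  choose c hc using h
  refine ⟨∑ i, c i • b i, ?_⟩
  rw [← (b.baseChange L).sum_repr x, TensorProduct.tmul_sum]
  refine Finset.sum_congr rfl fun i _ => ?_
  rw [← hc, Module.Basis.baseChange_apply, TensorProduct.smul_tmul', smul_eq_mul, mul_one,
    ← TensorProduct.smul_tmul, Algebra.algebraMap_eq_smul_one]

/-- Galois descent for subspaces of `L ⊗ A`, also for infinite `L / F`. The proof is by induction on
the number of nonzero coordinates: a nonzero element of minimal support in a stable subspace, scaled
to have a coordinate equal to `1`, is fixed by the Galois group. -/
theorem mem_span_of_galAction_stable [IsGalois F L] [FiniteDimensional F A]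
    (D : Submodule L (L ⊗[F] A))
    (hD : ∀ (σ : L ≃ₐ[F] L), ∀ x ∈ D, galAction A σ x ∈ D) (x : L ⊗[F] A) (hx : x ∈ D) :
    x ∈ Submodule.span L {y | ∃ a : A, y = 1 ⊗ₜ[F] a ∧ y ∈ D} := by
  classical
  let b := Module.finBasis F A
  let c : (L ⊗[F] A) → Fin (Module.finrank F A) → L := fun x i => (b.baseChange L).repr x i
  let supp : (L ⊗[F] A) → Finset (Fin (Module.finrank F A)) := fun x => {i | c x i ≠ 0}
  have hsupp : ∀ x i, i ∈ supp x ↔ c x i ≠ 0 := fun x i => by simp [supp]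
  have hsupp0 : ∀ x, supp x = ∅ → x = 0 := fun x h => by
    apply (b.baseChange L).repr.injective
    ext i
    by_contra h'
    have : i ∈ supp x := (hsupp x i).2 (by simpa using h')
    simp [h] at this
  -- subtracting a multiple of `z` kills a coordinate of `y` without enlarging the support
  have hlt : ∀ y z : L ⊗[F] A, supp z ⊆ supp y → ∀ i, c y i ≠ 0 → c z i = 1 →
      supp (y - c y i • z) ⊂ supp y := fun y z hzy i hy hz => by
    refine Finset.ssubset_iff_subset_ne.2 ⟨fun j hj => ?_, fun h => ?_⟩
    · rw [hsupp] at hj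
      by_contra hj'
      have hzj : c z j = 0 := by
        by_contra h
        exact hj' (hzy ((hsupp z j).2 h))
      have hyj : c y j = 0 := by
        by_contra h
        exact hj' ((hsupp y j).2 h)
      exact hj (by simp only [c, map_sub, map_smul, Finsupp.sub_apply, Finsupp.smul_apply] at *
                   rw [hzj, hyj]; simp)
    · have : i ∈ supp (y - c y i • z) := h ▸ (hsupp y i).2 hy
      rw [hsupp] at this
      apply this
      simp only [c, map_sub, map_smul, Finsupp.sub_apply, Finsupp.smul_apply] at *
      rw [hz]
      simp
  -- below every nonzero element of `D` lies a nonzero element defined over `F`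
  have key : ∀ n, ∀ y ∈ D, y ≠ 0 → (supp y).card ≤ n →
      ∃ a : A, (1 ⊗ₜ[F] a : L ⊗[F] A) ∈ D ∧ supp (1 ⊗ₜ a) ⊆ supp y ∧
        ∃ i, c (1 ⊗ₜ a) i = 1 := by
    intro n
    induction n with
    | zero =>
      intro y _ hy0 hc
      exact absurd (hsupp0 y (by simpa using hc)) hy0
    | succ n ih =>
      intro y hy hy0 hc
      obtain ⟨i, hi⟩ : (supp y).Nonempty := Finset.nonempty_iff_ne_empty.2 fun h =>
        hy0 (hsupp0 y h)
      rw [hsupp] at hi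
      let z := (c y i)⁻¹ • y
      have hzD : z ∈ D := D.smul_mem _ hy
      have hcz : ∀ j, c z j = (c y i)⁻¹ * c y j := fun j => by simp [c, z]
      have hzi : c z i = 1 := by rw [hcz, inv_mul_cancel₀ hi]
      have hzs : supp z = supp y := by
        ext j
        rw [hsupp, hsupp, hcz]
        simp [hi]
      by_cases hfix : ∀ σ : L ≃ₐ[F] L, galAction A σ z = z
      · obtain ⟨a, ha⟩ := exists_eq_one_tmul_of_galAction_eq z hfix
        rw [ha] at hzD hzs hzi
        exact ⟨a, hzD, hzs.subset, i, hzi⟩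
      · push Not at hfix
        obtain ⟨σ, hσ⟩ := hfix
        have hσz : ∀ j, c (galAction A σ z) j = σ (c z j) := fun j => repr_galAction b σ z j
        have hσi : c (galAction A σ z) i = 1 := by rw [hσz, hzi, map_one]
        have hσs : supp (galAction A σ z) = supp z := by
          ext j
          rw [hsupp, hsupp, hσz]
          simp
        have hss := hlt (galAction A σ z) z hσs.ge i (by rw [hσi]; exact one_ne_zero) hzi
        rw [hσi, one_smul, hσs, hzs] at hss
        obtain ⟨a, ha, has, hai⟩ := ih (galAction A σ z - z) (D.sub_mem (hD σ z hzD) hzD)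
          (sub_ne_zero.2 hσ) (Nat.le_of_lt_succ ((Finset.card_lt_card hss).trans_le hc))
        exact ⟨a, ha, has.trans hss.subset, hai⟩
  have main : ∀ n, ∀ y ∈ D, (supp y).card ≤ n →
      y ∈ Submodule.span L {y | ∃ a : A, y = 1 ⊗ₜ[F] a ∧ y ∈ D} := by
    intro n
    induction n with
    | zero =>
      intro y _ hc
      rw [hsupp0 y (by simpa using hc)]
      exact Submodule.zero_mem _
    | succ n ih =>
      intro y hy hc
      by_cases hy0 : y = 0
      · rw [hy0]
        exact Submodule.zero_mem _
      obtain ⟨a, ha, has, i, hai⟩ := key _ y hy hy0 le_rfl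
      have hyi : c y i ≠ 0 := (hsupp y i).1 (has ((hsupp _ i).2 (by rw [hai]; exact one_ne_zero)))
      have hss := hlt y _ has i hyi hai
      rw [← sub_add_cancel y (c y i • (1 ⊗ₜ[F] a))]
      exact Submodule.add_mem _ (ih _ (D.sub_mem hy (D.smul_mem _ ha))
        (Nat.le_of_lt_succ ((Finset.card_lt_card hss).trans_le hc)))
        (Submodule.smul_mem _ _ (Submodule.subset_span ⟨a, rfl, ha⟩))
  exact main _ x hx le_rfl

/-- A Galois stable right ideal of `L ⊗ A`, with `A` semisimple, is generated by an idempotent of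
`A`. -/
theorem exists_idempotent_of_galAction_stable [IsGalois F L] [FiniteDimensional F A]
    [IsSemisimpleRing A]
    (D : Submodule L (L ⊗[F] A)) (hr : ∀ x ∈ D, ∀ y, x * y ∈ D)
    (hD : ∀ (σ : L ≃ₐ[F] L), ∀ x ∈ D, galAction A σ x ∈ D) :
    ∃ e : A, IsIdempotentElem e ∧ ∀ x, x ∈ D ↔ (1 ⊗ₜ e : L ⊗[F] A) * x = x := by
  let J : Ideal Aᵐᵒᵖ :=
    { carrier := {a | (1 ⊗ₜ a.unop : L ⊗[F] A) ∈ D}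
      zero_mem' := by simp
      add_mem' := fun {a b} ha hb => by
        simpa [TensorProduct.tmul_add] using D.add_mem ha hb
      smul_mem' := fun c a ha => by
        simpa using hr _ ha (1 ⊗ₜ c.unop) }
  obtain ⟨f, hf, hJ⟩ := IsSemisimpleRing.ideal_eq_span_idempotent J
  have hfe : IsIdempotentElem f.unop := by
    have := congrArg MulOpposite.unop hf.eq
    simpa [IsIdempotentElem] using this
  have hmem : ∀ a : A, (1 ⊗ₜ a : L ⊗[F] A) ∈ D → f.unop * a = a := fun a ha => by
    have : MulOpposite.op a ∈ J := ha
    rw [hJ] at this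
    obtain ⟨c, hc⟩ := Ideal.mem_span_singleton'.1 this
    have hc' : f.unop * c.unop = a := by
      have := congrArg MulOpposite.unop hc
      simpa using this
    rw [← hc', ← mul_assoc, hfe.eq]
  have hfD : (1 ⊗ₜ f.unop : L ⊗[F] A) ∈ D := by
    have : f ∈ J := hJ ▸ Ideal.mem_span_singleton_self f
    exact this
  refine ⟨f.unop, hfe, fun x => ⟨fun hx => ?_, fun hx => hx ▸ hr _ hfD x⟩⟩
  have hspan := mem_span_of_galAction_stable D hD x hx
  clear hx
  induction hspan using Submodule.span_induction with
  | mem y hy =>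
    obtain ⟨a, rfl, ha⟩ := hy
    simp [hmem a ha]
  | zero => simp
  | add x y _ _ hx hy => rw [mul_add, hx, hy]
  | smul c x _ hx => rw [mul_smul_comm, hx]

end Descent

/-! ### Base change of a splitting -/

section Splitting

variable {F : Type u} [Field F] {A : Type v} [Ring A] [Algebra F A]
  {L : Type u} [Field L] [Algebra F L] {V : Type w} [AddCommGroup V] [Module L V]
  (φ : (L ⊗[F] A) ≃ₐ[L] Module.End L V)
  (R : Type u) [CommRing R] [Algebra F R] [Algebra L R] [IsScalarTower F L R]

theorem splittingAction_mul (x y : R ⊗[F] A) :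
    splittingAction φ R (x * y) = splittingAction φ R x * splittingAction φ R y := by
  induction x using TensorProduct.induction_on with
  | zero => simp
  | add x x' hx hx' => rw [add_mul, map_add, hx, hx', map_add, add_mul]
  | tmul c x =>
    induction y using TensorProduct.induction_on with
    | zero => simp
    | add y y' hy hy' => rw [mul_add, map_add, hy, hy', map_add, mul_add]
    | tmul c' y =>
      have : (1 ⊗ₜ (x * y) : L ⊗[F] A) = (1 ⊗ₜ x) * (1 ⊗ₜ y) := by simp
      rw [Algebra.TensorProduct.tmul_mul_tmul, splittingAction_tmul, splittingAction_tmul,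
        splittingAction_tmul, this, map_mul, LinearMap.baseChange_mul, smul_mul_smul_comm]

theorem splittingAction_bijective [FiniteDimensional L V] :
    Function.Bijective (splittingAction φ R) := by
  have hbc : IsBaseChange R (LinearMap.baseChangeHom L R V V) :=
    have := Module.finitePresentation_of_finite L V
    Module.FinitePresentation.isBaseChange_map L V V R
  let e := ((TensorProduct.AlgebraTensorModule.cancelBaseChange F L R R A).symm.trans
    (φ.toLinearEquiv.baseChange L R _ _)).trans hbc.equiv
  have : splittingAction φ R = e.toLinearMap := by
    ext a : 3
    simp [e, splittingAction_tmul, IsBaseChange.equiv_tmul]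
  rw [this]
  exact e.bijective

include φ in
theorem finrank_eq_mul_of_splitting [FiniteDimensional L V] :
    Module.finrank F A = Module.finrank L V * Module.finrank L V := by
  rw [← Module.finrank_baseChange (R := L) (S := F), φ.toLinearEquiv.finrank_eq,
    Module.finrank_linearMap]

include φ in
theorem algDegree_of_splitting [FiniteDimensional L V] : algDegree F A = Module.finrank L V := by
  rw [algDegree, finrank_eq_mul_of_splitting φ, Nat.sqrt_eq]

variable {R} in
theorem idealImage_le_iff {I : Submodule R (R ⊗[F] A)} {M : Submodule R (R ⊗[L] V)} :
    idealImage φ I ≤ M ↔ ∀ x ∈ I, ∀ m, splittingAction φ R x m ∈ M := by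
  simp only [idealImage, iSup_le_iff, LinearMap.range_le_iff_comap, Submodule.eq_top_iff',
    Submodule.mem_comap]

variable [FiniteDimensional L V] (W : Submodule L V) {k : ℕ} (hkW : k ≤ Module.finrank L W)

/-- The quotient of `V_R` by a submodule `N` of `W_R` is the sum of `W_R ⧸ N` and a free module. -/
noncomputable def quotientMapSubtypeEquiv (N : Submodule R (R ⊗[L] W)) :
    ((R ⊗[L] V) ⧸ N.map (W.subtype.baseChange R)) ≃ₗ[R]
      (R ⊗[L] (V ⧸ W)) × ((R ⊗[L] W) ⧸ N) :=
  have hex := LinearMap.exists_leftInverse_of_injective W.subtype W.ker_subtype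
  let π := hex.choose
  have hπ : π ∘ₗ W.subtype = LinearMap.id := hex.choose_spec
  quotientMapEquivProd (W.subtype.baseChange R) (π.baseChange R) (W.mkQ.baseChange R)
    (fun x => by
      rw [← LinearMap.comp_apply, ← LinearMap.baseChange_comp, hπ, LinearMap.baseChange_id]
      rfl)
    (LinearMap.baseChange_surjective R W.mkQ_surjective)
    (fun m => by
      let h : (V ⧸ W) →ₗ[L] V := W.liftQ (LinearMap.id - W.subtype ∘ₗ π) fun w hw => by
        have := LinearMap.congr_fun hπ ⟨w, hw⟩
        simp only [LinearMap.comp_apply, Submodule.subtype_apply, LinearMap.id_apply] at this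
        simp [this]
      have hsum : ∀ m, m = W.subtype.baseChange R (π.baseChange R m) +
          h.baseChange R (W.mkQ.baseChange R m) := fun m => by
        rw [← LinearMap.comp_apply, ← LinearMap.comp_apply, ← LinearMap.baseChange_comp,
          ← LinearMap.baseChange_comp, ← LinearMap.add_apply, ← LinearMap.baseChange_add]
        have : W.subtype ∘ₗ π + h ∘ₗ W.mkQ = LinearMap.id := by
          ext v
          simp [h]
        rw [this, LinearMap.baseChange_id]
        rfl
      constructor
      · intro hm
        conv_rhs => rw [hsum m, hm, map_zero, add_zero]
      · intro hm
        have : W.mkQ ∘ₗ W.subtype = 0 := by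
          ext v
          simp
        rw [← hm, ← LinearMap.comp_apply, ← LinearMap.baseChange_comp, this,
          LinearMap.baseChange_zero, LinearMap.zero_apply])
    N

include hkW in
/-- The right ideals attached to points of `Gr(k, W)` are points of `V_k(A)`, and conversely. -/
theorem hasConstRank_quotient_idealOfImage_iff (hn : 0 < Module.finrank L V)
    (N : Submodule R (R ⊗[L] W)) :
    HasConstRank R ((R ⊗[F] A) ⧸
        idealOfImage (splittingAction φ R) (N.map (W.subtype.baseChange R)))
        (Module.finrank F A - k * algDegree F A) ↔
      HasConstRank R ((R ⊗[L] W) ⧸ N) (Module.finrank L W - k) := by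
  have hW : Module.finrank L W ≤ Module.finrank L V := W.finrank_le
  have hVW : HasConstRank R (R ⊗[L] (V ⧸ W)) (Module.finrank L V - Module.finrank L W) :=
    .baseChange W.finrank_quotient
  have e1 := quotientIdealOfImageEquiv ((Module.finBasis L V).baseChange R)
    (splittingAction_bijective φ R).2 (N.map (W.subtype.baseChange R))
  have e2 := quotientMapSubtypeEquiv R W N
  have h1 : Module.finrank F A - k * algDegree F A =
      Module.finrank L V * (Module.finrank L V - k) := by
    rw [algDegree_of_splitting φ, finrank_eq_mul_of_splitting φ, ← Nat.sub_mul, mul_comm]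
  have h2 : Module.finrank L V - k = (Module.finrank L V - Module.finrank L W) +
      (Module.finrank L W - k) := by lia
  rw [h1, h2]
  constructor
  · intro h
    exact (((h.congr e1).of_pi hn).congr e2).of_prod hVW
  · intro h
    exact (((hVW.prod h).congr e2.symm).pi _).congr e1.symm

variable {W} {e : A} (heW : ∀ v, φ (1 ⊗ₜ e) v ∈ W) (heW' : ∀ w ∈ W, φ (1 ⊗ₜ e) w = w)

include heW heW' in
omit [FiniteDimensional L V] in
theorem splittingAction_idempotent_eq_self_iff (m : R ⊗[L] V) :
    splittingAction φ R (1 ⊗ₜ e) m = m ↔ m ∈ LinearMap.range (W.subtype.baseChange R) := by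
  have h : φ (1 ⊗ₜ e) = W.subtype ∘ₗ (φ (1 ⊗ₜ e)).codRestrict W heW := rfl
  rw [splittingAction_tmul, one_smul]
  constructor
  · intro hm
    rw [← hm, h, LinearMap.baseChange_comp]
    exact ⟨_, rfl⟩
  · rintro ⟨y, rfl⟩
    have : φ (1 ⊗ₜ e) ∘ₗ W.subtype = W.subtype := by
      ext w
      exact heW' _ w.2
    rw [← LinearMap.comp_apply, ← LinearMap.baseChange_comp, this]

include heW heW' in
theorem idempotent_mul_eq_self_iff (x : R ⊗[F] A) :
    (1 ⊗ₜ e) * x = x ↔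
      ∀ m, splittingAction φ R x m ∈ LinearMap.range (W.subtype.baseChange R) := by
  rw [← (splittingAction_bijective φ R).1.eq_iff, splittingAction_mul, LinearMap.ext_iff]
  exact forall_congr' fun m => splittingAction_idempotent_eq_self_iff φ R heW heW' _

variable {R}

include heW heW' hkW in
/-- A point `I` of `V_k(A)` over an `L`-algebra has image a point of `Gr(k, W)` if and only if it
is contained in the right ideal generated by `e`, where `e` acts as a projection onto `W`. -/
theorem exists_grassmannian_iff (hn : 0 < Module.finrank L V) (I : Submodule R (R ⊗[F] A))
    (hI : IsRightIdeal F A I)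
    (hrank : HasConstRank R ((R ⊗[F] A) ⧸ I) (Module.finrank F A - k * algDegree F A)) :
    (∃ N : Module.Grassmannian R (R ⊗[L] W) (Module.finrank L W - k),
        N.toSubmodule.map (W.subtype.baseChange R) = idealImage φ I) ↔
      ∀ x ∈ I, (1 ⊗ₜ e) * x = x := by
  have hle : (∀ x ∈ I, (1 ⊗ₜ e) * x = x) ↔
      idealImage φ I ≤ LinearMap.range (W.subtype.baseChange R) := by
    rw [idealImage_le_iff]
    exact forall₂_congr fun x _ => idempotent_mul_eq_self_iff φ R heW heW' x
  rw [hle]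
  constructor
  · rintro ⟨N, hN⟩
    rw [← hN]
    exact LinearMap.map_le_range
  · intro h
    have hN := Submodule.map_comap_eq_of_le h
    refine ⟨HasConstRank.grassmannian (S := (idealImage φ I).comap (W.subtype.baseChange R))
      ((hasConstRank_quotient_idealOfImage_iff φ R W hkW hn _).1 ?_), hN⟩
    rw [hN, idealImage, idealOfImage_iSup_range (splittingAction_mul φ R)
      (splittingAction_bijective φ R) ((Module.finBasis L V).baseChange R) I hI]
    exact hrank

end Splitting

/-! ### Base change of points of the Grassmannian -/

section Map

variable {F : Type*} [Field F] {M : Type*} [AddCommGroup M] [Module F M] {q : ℕ}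
  {R S : Type u} [CommRing R] [Algebra F R] [CommRing S] [Algebra F S]

theorem exact_baseChange_subtype_mkQ [Algebra R S] {M : Type*} [AddCommGroup M] [Module R M]
    (N : Submodule R M) : Function.Exact (N.subtype.baseChange S) (N.mkQ.baseChange S) :=
  lTensor_exact S (LinearMap.exact_subtype_mkQ N) N.mkQ_surjective

theorem ker_baseChangeMkQ_eq_span [Algebra R S] [IsScalarTower F R S]
    (N : Submodule R (R ⊗[F] M)) :
    LinearMap.ker (Module.Grassmannian.baseChangeMkQ S N) =
      Submodule.span S ((IsScalarTower.toAlgHom F R S).toLinearMap.rTensor M '' N) := by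
  have hf : ∀ x : R ⊗[F] M, AlgebraTensorModule.cancelBaseChange F R S S M (1 ⊗ₜ x) =
      (IsScalarTower.toAlgHom F R S).toLinearMap.rTensor M x := fun x => by
    induction x using TensorProduct.induction_on with
    | zero => simp
    | add x y hx hy => rw [TensorProduct.tmul_add, map_add, hx, hy, map_add]
    | tmul r m => simp [Algebra.smul_def]
  have hex : Function.Exact (N.subtype.baseChange S) (N.mkQ.baseChange S) :=
    exact_baseChange_subtype_mkQ N
  have hker : ∀ x, x ∈ LinearMap.ker (Module.Grassmannian.baseChangeMkQ S N) ↔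
      (AlgebraTensorModule.cancelBaseChange F R S S M).symm x ∈
        Set.range (N.subtype.baseChange S) := fun x => (hex _)
  apply le_antisymm
  · intro x hx
    obtain ⟨z, hz⟩ := (hker x).1 hx
    rw [LinearEquiv.eq_symm_apply] at hz
    rw [← hz]
    clear hz hx
    induction z using TensorProduct.induction_on with
    | zero => simp
    | add z w hz hw =>
      rw [map_add, map_add]
      exact Submodule.add_mem _ hz hw
    | tmul s n =>
      rw [LinearMap.baseChange_tmul, Submodule.subtype_apply, ← mul_one s, ← smul_eq_mul,
        ← TensorProduct.smul_tmul', map_smul, hf]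
      exact Submodule.smul_mem _ _ (Submodule.subset_span ⟨n, n.2, rfl⟩)
  · rw [Submodule.span_le]
    rintro _ ⟨n, hn, rfl⟩
    refine (hker _).2 ⟨1 ⊗ₜ ⟨n, hn⟩, ?_⟩
    rw [← hf, LinearEquiv.symm_apply_apply]
    rfl

/-- The base change of a point of the Grassmannian is spanned by its image. -/
theorem grassmannian_map_eq_span (f : R →ₐ[F] S) (N : Module.Grassmannian R (R ⊗[F] M) q) :
    (Module.Grassmannian.map f N).toSubmodule =
      Submodule.span S (f.toLinearMap.rTensor M '' N.toSubmodule) := by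
  let : Algebra R S := f.toAlgebra
  let : IsScalarTower F R S :=
    IsScalarTower.of_algebraMap_eq' <| IsScalarTower.algebraMap_eq F R S
  exact ker_baseChangeMkQ_eq_span N.toSubmodule

end Map

/-! ### The idempotent defining a closed subscheme -/

/-- Every vector lies in a subspace of any given positive dimension `k`, recorded here through the
dimension of the quotient. -/
theorem exists_mem_finrank_quotient_eq {K M : Type*} [Field K] [AddCommGroup M] [Module K M]
    [FiniteDimensional K M] {k : ℕ} (hk : 0 < k) (hkM : k ≤ Module.finrank K M) (y : M) :
    ∃ N : Submodule K M, y ∈ N ∧ Module.finrank K (M ⧸ N) = Module.finrank K M - k := by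
  suffices ∃ v : Fin k → M, LinearIndependent K v ∧ y ∈ Submodule.span K (Set.range v) by
    obtain ⟨v, hv, hy⟩ := this
    refine ⟨_, hy, ?_⟩
    rw [Submodule.finrank_quotient, finrank_span_eq_card hv, Fintype.card_fin]
  by_cases hy : y = 0
  · obtain ⟨v, hv⟩ := exists_linearIndependent_of_le_finrank hkM
    exact ⟨v, hv, hy ▸ Submodule.zero_mem _⟩
  induction k, hk using Nat.le_induction with
  | base =>
    exact ⟨fun _ => y, linearIndependent_unique_iff.2 hy,
      Submodule.subset_span ⟨0, rfl⟩⟩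
  | succ k hk ih =>
    obtain ⟨v, hv, hyv⟩ := ih (by lia)
    obtain ⟨x, hx⟩ := exists_linearIndependent_snoc_of_lt_finrank hv (by lia)
    refine ⟨_, hx, Submodule.span_mono ?_ hyv⟩
    rw [Fin.range_snoc]
    exact Set.subset_insert _ _

section Idempotent

variable {F : Type u} [Field F] {A : Type v} [Ring A] [Algebra F A]
  {L : Type u} [Field L] [Algebra F L] {V : Type w} [AddCommGroup V] [Module L V]
  [FiniteDimensional L V]
  {φ : (L ⊗[F] A) ≃ₐ[L] Module.End L V} {k : ℕ}
  {P : Subfunctor (generalizedSeveriBrauer F A k).toFunctor} {W : Submodule L V}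

omit [FiniteDimensional L V] in
theorem splittingAction_self (x : L ⊗[F] A) :
    splittingAction φ L x = (φ x).baseChange L := by
  induction x using TensorProduct.induction_on with
  | zero => simp
  | add x y hx hy => rw [map_add, map_add, hx, hy, LinearMap.baseChange_add]
  | tmul l a =>
    have : (l ⊗ₜ a : L ⊗[F] A) = l • (1 ⊗ₜ a) := by simp [TensorProduct.smul_tmul']
    rw [splittingAction_tmul, this, map_smul, LinearMap.baseChange_smul]

/-- The right ideal of all elements with image in `W` is Galois stable: it is spanned by the
`L`-points of `P`, and those are permuted by the Galois group. -/
theorem galAction_mem_of_isSubgrassmannian (hk : 0 < k) (hkW : k ≤ Module.finrank L W)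
    (hPW : IsSubgrassmannian φ P W) (σ : L ≃ₐ[F] L) (x : L ⊗[F] A)
    (hx : x ∈ idealOfImage (splittingAction φ L) (LinearMap.range (W.subtype.baseChange L))) :
    galAction A σ x ∈
      idealOfImage (splittingAction φ L) (LinearMap.range (W.subtype.baseChange L)) := by
  have hn : 0 < Module.finrank L V := (hk.trans_le hkW).trans_le W.finrank_le
  let b := (Module.finBasis L V).baseChange L
  have hbij := splittingAction_bijective φ L
  choose E hE using fun i => hbij.2 ((b.coord i).smulRight (b i))
  have hsum : x = ∑ i, x * E i := hbij.1 <| b.ext fun j => by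
    rw [map_sum, LinearMap.sum_apply]
    simp [splittingAction_mul, hE, Finsupp.single_apply, apply_ite]
  rw [hsum, map_sum]
  refine Submodule.sum_mem _ fun i _ => ?_
  -- the image of `x * E i` is contained in a `k`-dimensional subspace of `W`
  obtain ⟨y, hy⟩ := hx (b i)
  obtain ⟨N, hyN, hN⟩ := exists_mem_finrank_quotient_eq (K := L) (M := L ⊗[L] W) hk
    (by rwa [Module.finrank_baseChange]) y
  rw [Module.finrank_baseChange] at hN
  have hrank := (hasConstRank_quotient_idealOfImage_iff φ L W hkW hn N).2 (.of_free hN)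
  let I : (generalizedSeveriBrauer F A k).toFunctor.obj (CommAlgCat.of F L) :=
    ⟨hrank.grassmannian, fun z hz a => mul_mem_idealOfImage (splittingAction_mul φ L) hz a⟩
  have hIP : I ∈ P.obj (CommAlgCat.of F L) := (hPW L I).2
    ⟨(HasConstRank.of_free hN).grassmannian,
      (iSup_range_idealOfImage hbij b (N.map (W.subtype.baseChange L)) hn).symm⟩
  have hzI : x * E i ∈ I.1.toSubmodule := fun m => by
    rw [splittingAction_mul, hE]
    refine ⟨b.coord i m • y, N.smul_mem _ hyN, ?_⟩
    rw [map_smul, hy]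
    simp
  have hmap := P.map (CommAlgCat.ofHom σ.toAlgHom) hIP
  obtain ⟨N', hN'⟩ := (hPW L _).1 hmap
  have hmem : galAction A σ (x * E i) ∈ (Module.Grassmannian.map σ.toAlgHom I.1).toSubmodule := by
    rw [grassmannian_map_eq_span]
    exact Submodule.subset_span ⟨_, hzI, rfl⟩
  have hle : idealImage φ (Module.Grassmannian.map σ.toAlgHom I.1).toSubmodule ≤
      LinearMap.range (W.subtype.baseChange L) :=
    (show idealImage φ _ = _ from hN'.symm).trans_le LinearMap.map_le_range
  exact (idealImage_le_iff φ).1 hle _ hmem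

/-- The right ideal of all elements with image in `W` is generated by an idempotent of `A`, which
acts as a projection of `V` onto `W`. -/
theorem exists_idempotent_of_isSubgrassmannian [IsGalois F L] [FiniteDimensional F A]
    [IsSemisimpleRing A] (hk : 0 < k) (hkW : k ≤ Module.finrank L W)
    (hPW : IsSubgrassmannian φ P W) :
    ∃ e : A, IsIdempotentElem e ∧ (∀ v, φ (1 ⊗ₜ e) v ∈ W) ∧ ∀ w ∈ W, φ (1 ⊗ₜ e) w = w := by
  obtain ⟨e, he, heD⟩ := exists_idempotent_of_galAction_stable _
    (fun x hx y => mul_mem_idealOfImage (splittingAction_mul φ L) hx y)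
    (galAction_mem_of_isSubgrassmannian hk hkW hPW)
  refine ⟨e, he, fun v => ?_, fun w hw => ?_⟩
  · have := (heD (1 ⊗ₜ e)).2 (by simp [he.eq]) (1 ⊗ₜ v)
    obtain ⟨y, hy⟩ := this
    rw [splittingAction_tmul, one_smul, LinearMap.baseChange_tmul] at hy
    have := congrArg (TensorProduct.lid L V) hy
    rw [TensorProduct.lid_tmul, one_smul] at this
    rw [← this]
    clear this hy
    induction y using TensorProduct.induction_on with
    | zero => simp
    | add y z hy hz =>
      rw [map_add, map_add]
      exact W.add_mem hy hz
    | tmul l w =>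
      rw [LinearMap.baseChange_tmul, TensorProduct.lid_tmul]
      exact W.smul_mem _ w.2
  · by_cases hw0 : w = 0
    · rw [hw0, map_zero]
    -- a rank one endomorphism fixing `w` has image in `W`
    obtain ⟨f, hf⟩ := Module.Projective.exists_dual_eq_one L hw0
    obtain ⟨x, hx⟩ := φ.surjective (f.smulRight w)
    have hxD := (heD x).1 fun m => by
      have : φ x = W.subtype ∘ₗ f.smulRight (⟨w, hw⟩ : W) := by
        rw [hx]
        rfl
      rw [splittingAction_self, this, LinearMap.baseChange_comp]
      exact ⟨_, rfl⟩
    have := LinearMap.congr_fun (congrArg φ hxD) w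
    rw [map_mul, Module.End.mul_apply, hx] at this
    simpa [hf] using this

end Idempotent

/-! ### The functor of points of the closed subscheme -/

section Descent

variable {F : Type u} [Field F] {A : Type v} [Ring A] [Algebra F A] {L : Type u} [Field L]
  [Algebra F L] {k : ℕ} {P : Subfunctor (generalizedSeveriBrauer F A k).toFunctor}

/-- Membership in a closed subfunctor may be checked after the faithfully flat base change from `F`
to `L`. -/
theorem mem_iff_map_includeRight_mem (hP : P.IsClosedSubfunctor) (R : CommAlgCat.{u} F)
    (I : (generalizedSeveriBrauer F A k).toFunctor.obj R) :
    (generalizedSeveriBrauer F A k).toFunctor.map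
      (CommAlgCat.ofHom (Algebra.TensorProduct.includeRight : R →ₐ[F] L ⊗[F] R)) I ∈
        P.obj (CommAlgCat.of F (L ⊗[F] R)) ↔ I ∈ P.obj R := by
  obtain ⟨𝔞, h𝔞⟩ := hP R I
  have hid := h𝔞 R (𝟙 R)
  rw [Functor.map_id_apply] at hid
  refine (h𝔞 _ _).trans (Iff.trans (forall₂_congr fun r _ => ?_) hid.symm)
  exact map_eq_zero_iff _ (Algebra.TensorProduct.includeRight_injective
    (algebraMap F L).injective)

variable {V : Type w} [AddCommGroup V] [Module L V] [FiniteDimensional L V]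
  {φ : (L ⊗[F] A) ≃ₐ[L] Module.End L V} {W : Submodule L V}

/-- The points of `P` are the points of `V_k(A)` contained in the right ideal generated by an
idempotent which acts as a projection onto `W`. -/
theorem mem_iff_idempotent_mul_eq_self (hP : P.IsClosedSubfunctor)
    (hkW : k ≤ Module.finrank L W) (hPW : IsSubgrassmannian φ P W)
    (hn : 0 < Module.finrank L V) {e : A} (heW : ∀ v, φ (1 ⊗ₜ e) v ∈ W)
    (heW' : ∀ w ∈ W, φ (1 ⊗ₜ e) w = w) (R : CommAlgCat.{u} F)
    (I : (generalizedSeveriBrauer F A k).toFunctor.obj R) :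
    I ∈ P.obj R ↔ ∀ x ∈ I.1.toSubmodule, (1 ⊗ₜ e) * x = x := by
  rw [← mem_iff_map_includeRight_mem (L := L) hP, hPW]
  let f : R →ₐ[F] L ⊗[F] R := Algebra.TensorProduct.includeRight
  let I' := (generalizedSeveriBrauer F A k).toFunctor.map (CommAlgCat.ofHom f) I
  rw [exists_grassmannian_iff φ hkW heW heW' hn I'.1.toSubmodule I'.2
    (HasConstRank.of_grassmannian I'.1)]
  have hspan : I'.1.toSubmodule = Submodule.span _ (f.toLinearMap.rTensor A '' I.1.toSubmodule) :=
    grassmannian_map_eq_span f I.1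
  have hf : ∀ x : R ⊗[F] A, (1 ⊗ₜ e) * f.toLinearMap.rTensor A x =
      f.toLinearMap.rTensor A ((1 ⊗ₜ e) * x) := fun x => by
    induction x using TensorProduct.induction_on with
    | zero => simp
    | add x y hx hy => rw [map_add, mul_add, hx, hy, mul_add, map_add]
    | tmul r a => simp
  have hinj : Function.Injective (f.toLinearMap.rTensor A) :=
    Module.Flat.rTensor_preserves_injective_linearMap _
      (Algebra.TensorProduct.includeRight_injective (algebraMap F L).injective)
  constructor
  · intro h x hx
    apply hinj
    rw [← hf]
    exact h _ (hspan ▸ Submodule.subset_span ⟨x, hx, rfl⟩)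
  · intro h y hy
    rw [hspan] at hy
    induction hy using Submodule.span_induction with
    | mem y hy =>
      obtain ⟨x, hx, rfl⟩ := hy
      rw [hf, h x hx]
    | zero => rw [mul_zero]
    | add y z _ _ hy hz => rw [mul_add, hy, hz]
    | smul c y _ hy => rw [mul_smul_comm, hy]

/-- A submodule of a projective module of constant rank vanishes if the quotient is projective of
the same rank. -/
theorem eq_bot_of_hasConstRank_quotient {R M : Type*} [CommRing R] [AddCommGroup M] [Module R M]
    {n : ℕ} (hM : HasConstRank R M n) (N : Submodule R M) (h : HasConstRank R (M ⧸ N) n) :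
    N = ⊥ := by
  have := h.projective
  obtain ⟨s, hs⟩ := Module.projective_lifting_property N.mkQ LinearMap.id N.mkQ_surjective
  have hs' : ∀ x, N.mkQ (s x) = x := LinearMap.congr_fun hs
  let π : M →ₗ[R] N := (LinearMap.id - s ∘ₗ N.mkQ).codRestrict N fun m => by
    refine (Submodule.Quotient.mk_eq_zero N).1 ?_
    change N.mkQ (m - s (N.mkQ m)) = 0
    rw [map_sub, hs', sub_self]
  have hπ : ∀ m, (π m : M) = m - s (N.mkQ m) := fun m => rfl
  have e := quotientMapEquivProd N.subtype π N.mkQ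
    (fun x => Subtype.ext (by
      have : N.mkQ (x : M) = 0 := by simp
      rw [Submodule.subtype_apply, hπ, this, map_zero, sub_zero]))
    N.mkQ_surjective (fun m => by
      rw [Submodule.subtype_apply, hπ]
      constructor
      · intro h
        rw [h, map_zero, sub_zero]
      · intro h
        rw [← h, map_sub, hs', sub_self]) ⊥
  have h0 : HasConstRank R (N ⧸ (⊥ : Submodule R N)) 0 :=
    ((hM.congr ((Submodule.quotEquivOfEqBot _ (Submodule.map_bot _)).symm)).congr e).of_prod
      (m := n) h
  have h0' := h0.congr (Submodule.quotEquivOfEqBot _ rfl)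
  have := h0'.finite
  have := h0'.projective
  have hsub := (Module.rankAtStalk_eq_zero_iff_subsingleton (R := R) (M := N)).1
    (funext h0'.rank_eq)
  exact (Submodule.subsingleton_iff_eq_bot).1 hsub

/-- `V_0(A)` is a point, so that it equals `P` if `k = 0`. -/
theorem mem_of_eq_zero {P : Subfunctor (generalizedSeveriBrauer F A 0).toFunctor}
    [FiniteDimensional F A] (hP : P.IsClosedSubfunctor) (hPW : IsSubgrassmannian φ P W)
    (R : CommAlgCat.{u} F) (I : (generalizedSeveriBrauer F A 0).toFunctor.obj R) :
    I ∈ P.obj R := by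
  rw [← mem_iff_map_includeRight_mem (L := L) hP, hPW]
  let f : R →ₐ[F] L ⊗[F] R := Algebra.TensorProduct.includeRight
  let I' := (generalizedSeveriBrauer F A 0).toFunctor.map (CommAlgCat.ofHom f) I
  have hI' : I'.1.toSubmodule = ⊥ :=
    eq_bot_of_hasConstRank_quotient (.baseChange (by simp)) _ (HasConstRank.of_grassmannian I'.1)
  have hW : HasConstRank (L ⊗[F] R) (((L ⊗[F] R) ⊗[L] W) ⧸ (⊥ : Submodule (L ⊗[F] R) _))
      (Module.finrank L W - 0) :=
    (HasConstRank.baseChange rfl).congr (Submodule.quotEquivOfEqBot _ rfl).symm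
  refine ⟨hW.grassmannian, ?_⟩
  change Submodule.map _ ⊥ = idealImage φ I'.1.toSubmodule
  rw [hI', Submodule.map_bot]
  symm
  rw [eq_bot_iff, idealImage_le_iff]
  rintro x hx m
  rw [(Submodule.mem_bot _).1 hx]
  simp

end Descent

/-! ### Morita equivalence on points -/

namespace FullCorner

section

variable {F : Type u} [Field F] {A B : Type v} [Ring A] [Algebra F A] [Ring B] [Algebra F B]
  {r s : ℕ} (D : FullCorner F A B r s)

/-- The quotient of `A` by the right ideal `e A`, realized as the complement `(1 - e) A`. -/
abbrev Complement : Submodule F A := LinearMap.range (LinearMap.mulLeft F (1 - D.e))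

/-- The projection of `A_R` onto `(1 - e) A_R`. -/
noncomputable def toComplement (R : Type u) [CommRing R] [Algebra F R] :
    R ⊗[F] A →ₗ[R] R ⊗[F] D.Complement :=
  (LinearMap.mulLeft F (1 - D.e)).rangeRestrict.baseChange R

variable (R : Type u) [CommRing R] [Algebra F R]

theorem toComplement_surjective : Function.Surjective (D.toComplement R) :=
  LinearMap.baseChange_surjective R (LinearMap.surjective_rangeRestrict _)

theorem toComplement_eq_zero_iff (x : R ⊗[F] A) :
    D.toComplement R x = 0 ↔ (D.baseChange R).e * x = x := by
  have hinj : Function.Injective (D.Complement.subtype.baseChange R) :=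
    Module.Flat.lTensor_preserves_injective_linearMap _ D.Complement.subtype_injective
  have h : D.Complement.subtype.baseChange R (D.toComplement R x) =
      x - (D.baseChange R).e * x := by
    rw [toComplement, ← LinearMap.comp_apply, ← LinearMap.baseChange_comp,
      show D.Complement.subtype ∘ₗ (LinearMap.mulLeft F (1 - D.e)).rangeRestrict =
        LinearMap.mulLeft F (1 - D.e) from rfl]
    induction x using TensorProduct.induction_on with
    | zero => simp
    | add x y hx hy => rw [map_add, hx, hy, mul_add]; abel
    | tmul c x => simp [baseChange, sub_mul, TensorProduct.tmul_sub]
  rw [← map_eq_zero_iff _ hinj, h, sub_eq_zero, eq_comm]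

/-- The first relation expresses `A ^ s ≃ ((1 - e) A) ^ s × B ^ r`, and the second
`M_s(A) ≃ M_r(B)`. -/
theorem finrank_relation [FiniteDimensional F A] [FiniteDimensional F B] :
    s * Module.finrank F A = s * Module.finrank F D.Complement + r * Module.finrank F B ∧
      s * s * Module.finrank F A = r * r * Module.finrank F B := by
  constructor
  · have e := D.quotientEquiv (LinearMap.mulLeft F (1 - D.e)).rangeRestrict
      (LinearMap.surjective_rangeRestrict _)
      (fun x => by
        rw [Subtype.ext_iff]
        change (1 - D.e) * x = 0 ↔ _
        rw [sub_mul, one_mul, sub_eq_zero, eq_comm])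
      ⊥ (fun x hx a => by simp [(Submodule.mem_bot _).1 hx])
      (fun x hx => by simp [(Submodule.mem_bot _).1 hx])
    have hcomap : (⊥ : Submodule F A).comap D.ι = ⊥ :=
      (LinearMap.ker_eq_bot).2 D.ι_injective
    have h1 := (Submodule.quotEquivOfEqBot (⊥ : Submodule F A) rfl).finrank_eq
    have h2 := (Submodule.quotEquivOfEqBot _ hcomap).finrank_eq
    have := e.finrank_eq
    rw [Module.finrank_prod] at this
    simpa only [Module.finrank_pi_fintype, h1, h2, Finset.sum_const, Finset.card_univ,
      Fintype.card_fin, smul_eq_mul] using this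
  · simpa [Module.finrank_matrix] using D.matrixEquiv.toLinearEquiv.finrank_eq

end

section

variable {F : Type u} [Field F] {A B : Type v} [Ring A] [Algebra F A] [Ring B] [Algebra F B]
  {r s : ℕ} (D : FullCorner F A B r s) {R S : Type u} [CommRing R] [Algebra F R]
  [CommRing S] [Algebra F S]

/-- Intersecting right ideals with the corner commutes with base change. -/
theorem comap_span_rTensor (f : R →ₐ[F] S) (I : Submodule R (R ⊗[F] A))
    (hI : ∀ x ∈ I, ∀ a, x * a ∈ I) (he : ∀ x ∈ I, (D.baseChange R).e * x = x) :
    (Submodule.span S (f.toLinearMap.rTensor A '' I)).comap (D.baseChange S).ι =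
      Submodule.span S (f.toLinearMap.rTensor B '' (I.comap (D.baseChange R).ι)) := by
  have hι : ∀ y : R ⊗[F] B, (D.baseChange S).ι (f.toLinearMap.rTensor B y) =
      f.toLinearMap.rTensor A ((D.baseChange R).ι y) := fun y => by
    induction y using TensorProduct.induction_on with
    | zero => simp
    | add x y hx hy => rw [map_add, map_add, hx, hy, map_add, map_add]
    | tmul c y => simp [baseChange]
  have hρ : ∀ x : R ⊗[F] A, (D.baseChange S).ρ (f.toLinearMap.rTensor A x) =
      f.toLinearMap.rTensor B ((D.baseChange R).ρ x) := fun x => by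
    induction x using TensorProduct.induction_on with
    | zero => simp
    | add x y hx hy => rw [map_add, map_add, hx, hy, map_add, map_add]
    | tmul c x => simp [baseChange]
  apply le_antisymm
  · suffices ∀ z ∈ Submodule.span S (f.toLinearMap.rTensor A '' I), (D.baseChange S).ρ z ∈
        Submodule.span S (f.toLinearMap.rTensor B '' (I.comap (D.baseChange R).ι)) from
      fun y hy => (D.baseChange S).ρ_ι y ▸ this _ hy
    intro z hy
    induction hy using Submodule.span_induction with
    | mem z hz =>
      obtain ⟨x, hx, rfl⟩ := hz
      rw [hρ]
      refine Submodule.subset_span ⟨_, ?_, rfl⟩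
      rw [SetLike.mem_coe, Submodule.mem_comap, (D.baseChange R).ι_ρ, he x hx]
      exact hI x hx _
    | zero => simp
    | add z z' _ _ hz hz' =>
      rw [map_add]
      exact Submodule.add_mem _ hz hz'
    | smul c z _ hz =>
      rw [map_smul]
      exact Submodule.smul_mem _ c hz
  · rw [Submodule.span_le]
    rintro _ ⟨y, hy, rfl⟩
    rw [SetLike.mem_coe, Submodule.mem_comap, hι]
    exact Submodule.subset_span ⟨_, hy, rfl⟩

theorem comap_grassmannian_map {a b : ℕ} (f : R →ₐ[F] S) (I : Module.Grassmannian R (R ⊗[F] A) a)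
    (hI : ∀ x ∈ I.toSubmodule, ∀ a, x * a ∈ I.toSubmodule)
    (he : ∀ x ∈ I.toSubmodule, (D.baseChange R).e * x = x)
    (K : Module.Grassmannian R (R ⊗[F] B) b)
    (hK : K.toSubmodule = I.toSubmodule.comap (D.baseChange R).ι) :
    (Module.Grassmannian.map f I).toSubmodule.comap (D.baseChange S).ι =
      (Module.Grassmannian.map f K).toSubmodule := by
  rw [grassmannian_map_eq_span, grassmannian_map_eq_span, hK]
  exact D.comap_span_rTensor f _ hI he

end

section

variable {F : Type u} [Field F] {A B : Type v} [Ring A] [Algebra F A] [Ring B] [Algebra F B]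
  {r s : ℕ} (D : FullCorner F A B r s) {k : ℕ} [FiniteDimensional F A]
  {P : Subfunctor (generalizedSeveriBrauer F A k).toFunctor} (hr : 0 < r) (hs : 0 < s)
  (hrank : s * (Module.finrank F A - k * algDegree F A) = s * Module.finrank F D.Complement +
    r * (Module.finrank F B - k * algDegree F B))
  (hP : ∀ (R : CommAlgCat.{u} F) (I : (generalizedSeveriBrauer F A k).toFunctor.obj R),
    I ∈ P.obj R ↔ ∀ x ∈ I.1.toSubmodule, (1 ⊗ₜ D.e) * x = x)

include hr hs hrank in
theorem hasConstRank_comap_iff (R : Type u) [CommRing R] [Algebra F R]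
    (I : Submodule R (R ⊗[F] A)) (hI : ∀ x ∈ I, ∀ a, x * a ∈ I)
    (he : ∀ x ∈ I, (D.baseChange R).e * x = x) :
    HasConstRank R ((R ⊗[F] A) ⧸ I) (Module.finrank F A - k * algDegree F A) ↔
      HasConstRank R ((R ⊗[F] B) ⧸ I.comap (D.baseChange R).ι)
        (Module.finrank F B - k * algDegree F B) :=
  (D.baseChange R).hasConstRank_iff hr hs (D.toComplement R) (D.toComplement_surjective R)
    (D.toComplement_eq_zero_iff R) (.baseChange rfl) hrank I hI he

/-- The bijection on points over `R`, sending a right ideal contained in `e A_R` to its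
intersection with the corner `B_R = e A_R e`. -/
noncomputable def pointsEquiv (R : CommAlgCat.{u} F) :
    P.toFunctor.obj R ≃ (generalizedSeveriBrauer F B k).toFunctor.obj R where
  toFun I := ⟨((D.hasConstRank_comap_iff hr hs hrank R I.1.1.toSubmodule I.1.2
      ((hP R I.1).1 I.2)).1 (.of_grassmannian I.1.1)).grassmannian,
    fun _ hy b => (D.baseChange R).mul_mem_comap I.1.2 hy b⟩
  invFun K :=
    have hK := (D.baseChange R).comap_extend K.1.toSubmodule K.2
    have he : ∀ x ∈ (D.baseChange R).extend K.1.toSubmodule, (D.baseChange R).e * x = x :=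
      fun _ hx => hx.1
    ⟨⟨((D.hasConstRank_comap_iff hr hs hrank R ((D.baseChange R).extend K.1.toSubmodule)
      (fun _ hx a => (D.baseChange R).mul_mem_extend hx a) he).2
        (by rw [hK]; exact .of_grassmannian K.1)).grassmannian,
      fun _ hx a => (D.baseChange R).mul_mem_extend hx a⟩, (hP R _).2 he⟩
  left_inv I := Subtype.ext <| Subtype.ext <| Module.Grassmannian.ext <|
    (D.baseChange R).extend_comap hs I.1.2 ((hP R I.1).1 I.2)
  right_inv K := Subtype.ext <| Module.Grassmannian.ext <|
    (D.baseChange R).comap_extend K.1.toSubmodule K.2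

/-- The functor of points of `P` is that of the generalized Severi-Brauer variety of the corner. -/
noncomputable def pointsIso : P.toFunctor ≅ (generalizedSeveriBrauer F B k).toFunctor :=
  NatIso.ofComponents (fun R => (D.pointsEquiv hr hs hrank hP R).toIso) fun {R S} f => by
    ext I
    refine Subtype.ext <| Module.Grassmannian.ext ?_
    exact D.comap_grassmannian_map f.hom I.1.1 I.1.2 ((hP R I.1).1 I.2)
      (D.pointsEquiv hr hs hrank hP R I).1 rfl

end

end FullCorner

/-! ### Degrees and conclusion -/

section Main

variable {F : Type u} [Field F] {A : Type v} [Ring A] [Algebra F A] [FiniteDimensional F A]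
  {L : Type u} [Field L] [Algebra F L] {V : Type w} [AddCommGroup V] [Module L V]
  [FiniteDimensional L V]

/-- If `e` acts as a projection onto a space of dimension `w`, then the right ideal `e A` has
dimension `w * n`, and its complement dimension `n * n - w * n`. -/
theorem finrank_complement (φ : (L ⊗[F] A) ≃ₐ[L] Module.End L V) {W : Submodule L V}
    (hn : 0 < Module.finrank L V) {B : Type v} [Ring B] [Algebra F B] {r s : ℕ}
    (D : FullCorner F A B r s) (heW : ∀ v, φ (1 ⊗ₜ D.e) v ∈ W)
    (heW' : ∀ w ∈ W, φ (1 ⊗ₜ D.e) w = w) :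
    Module.finrank F D.Complement =
      Module.finrank L V * Module.finrank L V - Module.finrank L W * Module.finrank L V := by
  have h := (hasConstRank_quotient_idealOfImage_iff φ L W le_rfl hn ⊤).2 <| .of_free <| by
    rw [Nat.sub_self, Module.finrank_zero_of_subsingleton]
  rw [algDegree_of_splitting φ, finrank_eq_mul_of_splitting φ] at h
  rw [← h.finrank_eq, ← Module.finrank_baseChange (R := L) (S := F),
    ← ((D.toComplement L).quotKerEquivOfSurjective (D.toComplement_surjective L)).finrank_eq]
  refine (Submodule.quotEquivOfEq _ _ ?_).finrank_eq
  ext x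
  rw [LinearMap.mem_ker, D.toComplement_eq_zero_iff, Submodule.map_top]
  exact idempotent_mul_eq_self_iff φ L heW heW' x

/-- The points of `P` over `R` are the right ideals contained in `e A_R`, for some idempotent `e`
of `A`. For `k = 0` the subspace `W` is not determined by `P`, but then `e = 1` has this property,
with `W' = V`. -/
theorem exists_idempotent_mem_iff [IsGalois F L] [IsSemisimpleRing A]
    {φ : (L ⊗[F] A) ≃ₐ[L] Module.End L V} {k : ℕ}
    {P : Subfunctor (generalizedSeveriBrauer F A k).toFunctor} (hP : P.IsClosedSubfunctor)
    {W : Submodule L V} (hkW : k ≤ Module.finrank L W) (hPW : IsSubgrassmannian φ P W)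
    (hn : 0 < Module.finrank L V) :
    ∃ (e : A) (W' : Submodule L V), IsIdempotentElem e ∧ 0 < Module.finrank L W' ∧
      k ≤ Module.finrank L W' ∧ (∀ v, φ (1 ⊗ₜ e) v ∈ W') ∧ (∀ w ∈ W', φ (1 ⊗ₜ e) w = w) ∧
      ∀ (R : CommAlgCat.{u} F) (I : (generalizedSeveriBrauer F A k).toFunctor.obj R),
        I ∈ P.obj R ↔ ∀ x ∈ I.1.toSubmodule, (1 ⊗ₜ e) * x = x := by
  rcases Nat.eq_zero_or_pos k with rfl | hk
  · refine ⟨1, ⊤, .one, by simpa using hn, Nat.zero_le _, fun _ => trivial, fun w _ => ?_,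
      fun R I => iff_of_true (mem_of_eq_zero hP hPW R I) fun x _ => ?_⟩
    · rw [← Algebra.TensorProduct.one_def, map_one, Module.End.one_apply]
    · rw [← Algebra.TensorProduct.one_def, one_mul]
  · obtain ⟨e, he, heW, heW'⟩ := exists_idempotent_of_isSubgrassmannian hk hkW hPW
    exact ⟨e, W, he, hk.trans_le hkW, hkW, heW, heW',
      mem_iff_idempotent_mul_eq_self hP hkW hPW hn heW heW'⟩

end Main

theorem mainTheorem6 {F : Type u} [Field F] (A : CSA.{u, v} F)
    {L : Type u} [Field L] [Algebra F L] [IsGalois F L]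
    {V : Type w} [AddCommGroup V] [Module L V] [FiniteDimensional L V]
    (φ : (L ⊗[F] A) ≃ₐ[L] Module.End L V)
    (k : ℕ) (P : Subfunctor (generalizedSeveriBrauer F A k).toFunctor)
    (hP : P.IsClosedSubfunctor)
    (W : Submodule L V) (hkW : k ≤ Module.finrank L W)
    (hPW : IsSubgrassmannian φ P W) :
    ∃ B : CSA.{u, v} F, IsBrauerEquivalent A B ∧ k ≤ algDegree F B ∧
      Nonempty (P.toFunctor ≅ (generalizedSeveriBrauer F B k).toFunctor) := by
  have hn : 0 < Module.finrank L V := by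
    have h := finrank_eq_mul_of_splitting φ
    have : 0 < Module.finrank F A := Module.finrank_pos
    by_contra h0
    simp_all
  have : IsArtinianRing A := .of_finite F A
  have : IsArtinianRing (A : Type v)ᵐᵒᵖ := .of_finite F _
  have := IsSimpleRing.isSemisimpleRing_iff_isArtinianRing.2 ‹IsArtinianRing A›
  obtain ⟨e, W', he, hw, hkw, heW, heW', hmem⟩ := exists_idempotent_mem_iff hP hkW hPW hn
  have he0 : e ≠ 0 := by
    rintro rfl
    obtain ⟨w, hw0⟩ := Module.finrank_pos_iff_exists_ne_zero.1 hw
    refine hw0 (Subtype.ext ?_)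
    rw [← heW' w w.2]
    simp
  obtain ⟨r, s, hr, hs, D, hDe⟩ := exists_fullCorner (F := F) he he0
  rw [← hDe] at heW heW' hmem
  have hfin : FiniteDimensional F he.Corner :=
    Module.Finite.of_injective D.ι D.ι_injective
  have hsimp : IsSimpleRing he.Corner := by
    have : Nonempty (Fin s) := ⟨⟨0, hs⟩⟩
    have := IsSimpleRing.of_ringEquiv D.matrixEquiv.toRingEquiv inferInstance
    exact isSimpleRing_of_matrix hr
  have hcent : Algebra.IsCentral F he.Corner := by
    have := Algebra.IsCentral.of_algEquiv F _ _ D.matrixEquiv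
    exact isCentral_of_matrix hr
  -- the degree of the corner is the dimension of the image of `e`
  obtain ⟨h1, h2⟩ := D.finrank_relation
  have hwn : Module.finrank L W' ≤ Module.finrank L V := W'.finrank_le
  have hcompl := finrank_complement φ hn D heW heW'
  have hA := finrank_eq_mul_of_splitting φ
  have hdegA := algDegree_of_splitting φ
  generalize Module.finrank L W' = w at *
  generalize Module.finrank L V = n at *
  obtain ⟨x, rfl⟩ := Nat.exists_eq_add_of_le hkw
  obtain ⟨y, rfl⟩ := Nat.exists_eq_add_of_le hwn
  have hc : Module.finrank F D.Complement = y * (k + x + y) := by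
    rw [hcompl, ← Nat.sub_mul, Nat.add_sub_cancel_left]
  rw [hA, hc] at h1
  rw [hA] at h2
  -- with `n = k + x + y` and `w = k + x`, this compares the dimensions of `A ^ s` and `(e A) ^ r`
  have h3 : s * (k + x + y) = r * (k + x) := by
    have h4 : r * Module.finrank F he.Corner = s * (k + x + y) * (k + x) := by
      linarith
    have h5 : s * (k + x + y) * (s * (k + x + y)) = s * (k + x + y) * (r * (k + x)) := by
      calc _ = r * (r * Module.finrank F he.Corner) := by linarith
        _ = _ := by rw [h4]; ring
    exact Nat.eq_of_mul_eq_mul_left (by positivity) h5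
  have hB : Module.finrank F he.Corner = (k + x) * (k + x) := by
    have h5 : r * r * Module.finrank F he.Corner = r * r * ((k + x) * (k + x)) := by
      rw [← h2]
      calc _ = s * (k + x + y) * (s * (k + x + y)) := by ring
        _ = _ := by rw [h3]; ring
    exact Nat.eq_of_mul_eq_mul_left (by positivity) h5
  have hdegB : algDegree F he.Corner = k + x := by rw [algDegree, hB, Nat.sqrt_eq]
  refine ⟨{ AlgCat.of F he.Corner with
    isCentral := hcent, isSimple := hsimp, fin_dim := hfin }, ⟨s, r, hs.ne', hr.ne',
      ⟨D.matrixEquiv⟩⟩, hdegB ▸ Nat.le_add_right k x, ⟨D.pointsIso hr hs ?_ hmem⟩⟩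
  rw [hc, hA, hB, hdegA, hdegB, ← Nat.sub_mul, ← Nat.sub_mul, Nat.add_sub_cancel_left,
    add_assoc k x y, Nat.add_sub_cancel_left, ← add_assoc]
  calc s * ((x + y) * (k + x + y)) = s * (y * (k + x + y)) + s * (k + x + y) * x := by ring
    _ = _ := by rw [h3]; ring
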